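/- \textbf{Setting.} Let $n=(n_1,n_2)$ with $n_\sigma\ge 1$, $\bar n=\max(n_1,n_2)$, $1\le p\le\infty$, $h_0>0$. \emph{Graph domains.} $\Omega\subset\mathbb R^2$ is a (bounded) graph domain with parameter $h_0$ if there are finitely many continuous functions $\varphi_r:[-a_r,a_r]\to\mathbb R$ with $a_r>h_0$, $\min\varphi_r>h_0$, and maps $\Sigma_r$, each a rotation by a multiple of $\pi/2$ followed by a translation, such that for all $0\le\delta\le h_0$ $$\Omega=\bigcup_r\Sigma_r(\Phi_r^\delta),\qquad \Phi_r^\delta=\{x:-a_r+\delta\le x_1\le a_r-\delta,\ \delta<x_2<\varphi_r(x_1)\}.$$ We say that the graphs lie in the boundary if no $\Sigma_r(t,\varphi_r(t))$, $|t|\le a_r$, belongs to $\Omega$. \emph{Knots.} For $\sigma=1,2$ let $T_\sigma=(\tau_{\sigma,k})_{k\in\mathbb Z}$ be nondecreasing with $\tau_{\sigma,k}<\tau_{\sigma,k+n_\sigma}$ and maximal spacing $h_\sigma=\sup_k(\tau_{\sigma,k+1}-\tau_{\sigma,k})\le h_0/(\bar n+1)$, such that the grid cells $\Gamma_k=\prod_\sigma[\tau_{\sigma,k_\sigma-1},\tau_{\sigma,k_\sigma}]$,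 $k\in\mathbb Z^2$, cover $\Omega$. For an open interval $\omega$, the condensed sequence $T_\sigma^\omega$ is $T_\sigma$ if $|\omega|>h_\sigma$; if $|\omega|\le h_\sigma$ it arises from $T_\sigma$ by moving all knots outside $\omega$ to the nearer end point of $\omega$. \emph{cdB-splines.} Let $S_i=\prod_\sigma[\tau_{\sigma,i_\sigma},\tau_{\sigma,i_\sigma+n_\sigma}]$ for $i\in\mathbb Z^2$, and let $J$ be the set of all $j=(i,\gamma)$ with $\gamma$ a connected component of $S_i\cap\Omega$; put $S_j^*=\gamma$. Let $W_{\sigma,j}$ be the connected component containing $\gamma$ of the intersection of $\Omega$ with the strip that extends $S_i$ to infinity in both senses of direction $\sigma$, and let $\omega_{\sigma,j}$ be the interior of the $\sigma$-th side of the bounding box of $W_{\sigma,j}$. Let $T^*_{\sigma,j}=T_\sigma^{\omega_{\sigma,j}}$, with maximal spacing $h^*_{\sigma,j}$, and $$B_j^*(x)=b_{1,j}(x_1)\,b_{2,j}(x_2)\,\chi_\gamma(x),$$ where $b_{\sigma,j}$ is the $i_\sigma$-th normalised B-spline of order $n_\sigma$ with knots $T^*_{\sigma,j}$. \emph{The functionals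 $P_j$.} For a knot sequence $t$, order $m$ and index $i$, let $I=[t_{i+K},t_{i+K+1}]$, $0\le K<m$, be a longest knot interval of $[t_i,t_{i+m}]$, let $\lambda_l=t_{i+K}+\frac{l-1}{m-1}|I|$, $l=1,\dots,m$ (for $m=1$: $\lambda_1=t_{i+K}$), and let $w_1,\dots,w_m$ solve $$\sum_{l'=1}^m w_{l'}(l'-l)^{m-1}=\frac{(m-1)^{m-1}}{|I|^{m-1}}\prod_{r=1}^{m-1}(t_{i+r}-\lambda_l),\qquad l=1,\dots,m\qquad(0^0=1).$$ Let $P_jq=\sum_{m_1=1}^{n_1}\sum_{m_2=1}^{n_2}w_{1,m_1}w_{2,m_2}\,q(\lambda_{1,m_1},\lambda_{2,m_2})$, where $w_{\sigma,\cdot},\lambda_{\sigma,\cdot}$ belong to the knots $T^*_{\sigma,j}$, order $n_\sigma$ and index $i_\sigma$. \emph{The boxes $H_j^*$ and projections $A_j$.} Let $S_j^+$ be the connected component containing $\gamma$ of $\Omega\cap N$, where $N$ is the bounding box of $\gamma$ enlarged by $h^*_{\sigma,j}$ on both sides in each direction $\sigma$. An \emph{admissible} $H_j^*\subset S_j^+$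 is a box which, for one direction $\sigma$ and the other direction $\rho$, is the product of $[\tau_{\sigma,i_\sigma}-h^*_{\sigma,j},\tau_{\sigma,i_\sigma}]$ or $[\tau_{\sigma,i_\sigma+n_\sigma},\tau_{\sigma,i_\sigma+n_\sigma}+h^*_{\sigma,j}]$ in direction $\sigma$ and an interval $\omega'\subset\omega_{\rho,j}$ (with or without end points) of length $h^*_{\rho,j}$ in direction $\rho$, and which contains a point of $S_j^*$ on the corresponding edge $x_\sigma=\tau_{\sigma,i_\sigma}$, respectively $x_\sigma=\tau_{\sigma,i_\sigma+n_\sigma}$, of $S_i$. With the tensor product Legendre polynomials $\ell_{\alpha,j}$ normalised in $L^2(H_j^*)$, set $A_jf=\sum_{\alpha_1<n_1,\,\alpha_2<n_2}\big(\int_{H_j^*}f\,\ell_{\alpha,j}\big)\ell_{\alpha,j}$, and $$Qf=\sum_{j\in J}B_j^*\,P_jA_jf .$$ For a connected component $\Gamma_\ell$ of some $\Gamma_k\cap\Omega$ let $J_\ell$ be the set of all $j\in J$ for which $S_j^*\cap\Gamma_\ell$ has nonempty interior. \textbf{Theorem.} For all $n$ and $p$ as above there is a constant $c_{n,p}$,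 depending only on $n$ and $p$, such that for all $h_0$, all graph domains $\Omega$ with parameter $h_0$ and all knot sequences as above: (a) If the graphs lie in the boundary, then every $j\in J$ has an admissible box $H_j^*$. (b) For every choice of admissible boxes $H_j^*$, $j\in J$, the quasi-interpolant $Q$ satisfies $Qq=q$ on $\Omega$ for every bivariate polynomial $q$ of degree $<n_\sigma$ in $x_\sigma$, $\sigma=1,2$; and for every $f\in L^p(\Omega)$ and every component $\Gamma_\ell$, the set $J_\ell$ is finite and $$\|Qf\|_{\Gamma_\ell,p}\le c_{n,p}\max_{j\in J_\ell}\|f\|_{H_j^*,p}$$ (the maximum over the empty set, which occurs only for cells $\Gamma_k$ of zero area, is $0$). -/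

import Mathlib

open MeasureTheory
open scoped ENNReal NNReal

noncomputable section

namespace CdSpline

/-- The plane `ℝ²`; the coordinate directions are `0` and `1` (`σ = 1, 2` in the usual notation). -/
abbrev Plane : Type := Fin 2 → ℝ

/-! ## Graph domains -/

/-- Rotation of the plane by `π / 2`. -/
def quarterTurn (x : Plane) : Plane := ![-(x 1), x 0]

/-- The axis-aligned isometry: rotation by `k * π / 2`, followed by translation by `v`. -/
def axisIsometry (k : ℕ) (v : Plane) (x : Plane) : Plane := quarterTurn^[k] x + v

/-- The region `Φ^δ = {x : -a+δ ≤ x₁ ≤ a-δ, δ < x₂ < φ(x₁)}` of the pair `Φ = [a, φ]`. -/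
def graphRegion (a : ℝ) (φ : ℝ → ℝ) (δ : ℝ) : Set Plane :=
  {x | -a + δ ≤ x 0 ∧ x 0 ≤ a - δ ∧ δ < x 1 ∧ x 1 < φ (x 0)}

/-- A representation of `Ω` as a bounded graph domain with parameter `h₀`: finitely many pairs
`Φ_r = [a_r, φ_r]` and axis-aligned isometries `Σ_r` with `a_r > h₀`, `min φ_r > h₀` and
`Ω = ⋃_r Σ_r(Φ_r^δ)` for every `0 ≤ δ ≤ h₀`. -/
structure GraphDomain (h₀ : ℝ) (Ω : Set Plane) where
  h₀_pos : 0 < h₀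
  R : ℕ
  a : Fin R → ℝ
  φ : Fin R → ℝ → ℝ
  rot : Fin R → ℕ
  shift : Fin R → Plane
  lt_a : ∀ r, h₀ < a r
  continuousOn_φ : ∀ r, ContinuousOn (φ r) (Set.Icc (-(a r)) (a r))
  lt_φ : ∀ r, ∀ t ∈ Set.Icc (-(a r)) (a r), h₀ < φ r t
  eq_iUnion : ∀ δ, 0 ≤ δ → δ ≤ h₀ →
    Ω = ⋃ r, axisIsometry (rot r) (shift r) '' graphRegion (a r) (φ r) δ

/-- The graphs of the functions `φ_r` do not enter `Ω`; since they lie in the closure of `Ω`,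
this says that they are pieces of the boundary of `Ω`. -/
def GraphDomain.GraphsInBoundary {h₀ : ℝ} {Ω : Set Plane} (G : GraphDomain h₀ Ω) : Prop :=
  ∀ r, ∀ t ∈ Set.Icc (-(G.a r)) (G.a r),
    axisIsometry (G.rot r) (G.shift r) ![t, G.φ r t] ∉ Ω

/-! ## Bounding boxes, neighbourhoods, components -/

/-- Lower left corner of the bounding box of `M`. -/
def lower (M : Set Plane) : Plane := fun σ => sInf ((fun x : Plane => x σ) '' M)

/-- Upper right corner of the bounding box of `M`. -/
def upper (M : Set Plane) : Plane := fun σ => sSup ((fun x : Plane => x σ) '' M)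

/-- The `h`-neighbourhood of a bounded nonempty set `M`: the points `x` such that the bounding box
of `M ∪ {x}` has size at most (size of the bounding box of `M`) `+ h`, in both coordinates. This is
the bounding box of `M`, enlarged by `h` on all sides. -/
def nbhd (M : Set Plane) (h : Plane) : Set Plane := Set.Icc (lower M - h) (upper M + h)

/-- The connected components of `M ∩ Ω`. -/
def components (Ω M : Set Plane) : Set (Set Plane) :=
  {γ | ∃ x ∈ M ∩ Ω, γ = connectedComponentIn (M ∩ Ω) x}

/-- The connected component of `M ∩ Ω` that contains the connected set `γ ⊆ M ∩ Ω`. -/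
def componentOf (Ω M γ : Set Plane) : Set Plane :=
  {y | ∃ x ∈ γ, y ∈ connectedComponentIn (M ∩ Ω) x}

/-! ## Univariate B-splines -/

/-- The normalised B-splines `b_i` of order `m` for the knots `t` (Cox–de Boor recursion, with the
convention `c / 0 = 0`). -/
def bspline (t : ℤ → ℝ) : ℕ → ℤ → ℝ → ℝ
  | 0, _, _ => 0
  | 1, i, x => Set.indicator (Set.Ico (t i) (t (i + 1))) 1 x
  | m + 2, i, x =>
      (x - t i) / (t (i + (m + 1)) - t i) * bspline t (m + 1) i x
      + (t (i + (m + 2)) - x) / (t (i + (m + 2)) - t (i + 1)) * bspline t (m + 1) (i + 1) x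

/-- The maximal spacing of the knots `t`. -/
def maxGap (t : ℤ → ℝ) : ℝ := ⨆ k : ℤ, (t (k + 1) - t k)

/-- Non-uniform condensation of the knots `t` with respect to the interval `(lo, hi)`: if its
length does not exceed the maximal spacing, all knots outside are moved to the nearer end point. -/
def condense (t : ℤ → ℝ) (lo hi : ℝ) (k : ℤ) : ℝ :=
  if hi - lo ≤ maxGap t then max lo (min hi (t k)) else t k

/-- A number `K < m` such that `[t_{i+K}, t_{i+K+1}]` is a longest knot interval of the support
`[t_i, t_{i+m}]` of the B-spline `b_i` of order `m`. -/
def longest (m : ℕ) (t : ℤ → ℝ) (i : ℤ) : ℕ :=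
  Classical.epsilon fun K : ℕ => K < m ∧ ∀ K' : ℕ, K' < m →
    t (i + K' + 1) - t (i + K') ≤ t (i + K + 1) - t (i + K)

/-- Left end of the longest knot interval. -/
def longLeft (m : ℕ) (t : ℤ → ℝ) (i : ℤ) : ℝ := t (i + longest m t i)

/-- Length of the longest knot interval. -/
def longLen (m : ℕ) (t : ℤ → ℝ) (i : ℤ) : ℝ :=
  t (i + longest m t i + 1) - t (i + longest m t i)

/-- The `m` equispaced evaluation points in the longest knot interval, end points included
(counted from `0`; for `m = 1` it is the left end point). -/
def evalPt (m : ℕ) (t : ℤ → ℝ) (i : ℤ) (l : Fin m) : ℝ :=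
  longLeft m t i + (l : ℝ) / ((m : ℝ) - 1) * longLen m t i

/-- `ψ_i(x) = (t_{i+1} - x) ⋯ (t_{i+m-1} - x)`. -/
def psi (m : ℕ) (t : ℤ → ℝ) (i : ℤ) (x : ℝ) : ℝ :=
  ∏ r ∈ Finset.range (m - 1), (t (i + r + 1) - x)

/-- The weights `w_1, …, w_m`: the solution of the regular linear system
`∑_l' w_l' (l' - l)^(m-1) = (m-1)^(m-1) / |I_i|^(m-1) * ψ_i(λ_l)`, where `λ_l` are the evaluation
points and `|I_i|` is the length of the longest knot interval. -/
def weight (m : ℕ) (t : ℤ → ℝ) (i : ℤ) : Fin m → ℝ :=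
  (Matrix.of fun l l' : Fin m => ((l' : ℝ) - (l : ℝ)) ^ (m - 1))⁻¹.mulVec
    fun l => ((m : ℝ) - 1) ^ (m - 1) / longLen m t i ^ (m - 1) * psi m t i (evalPt m t i l)

/-- The `L²`-normalised Legendre polynomial of degree `d` over an interval with end points
`lo < hi` (up to sign). -/
def legendre (lo hi : ℝ) (d : ℕ) (x : ℝ) : ℝ :=
  Real.sqrt ((2 * d + 1) / (hi - lo)) *
    Polynomial.aeval ((x - lo) / (hi - lo)) (Polynomial.shiftedLegendre d)

/-! ## Condensed diversified B-splines

`n` is the coordinate order, `T 0` and `T 1` are the knot sequences. -/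

section Bivariate

/-- The grid cell `Γ_k = [τ_{1,k₁-1}, τ_{1,k₁}] × [τ_{2,k₂-1}, τ_{2,k₂}]`. -/
def gridCell (T : Fin 2 → ℤ → ℝ) (k : Fin 2 → ℤ) : Set Plane :=
  Set.Icc (fun σ => T σ (k σ - 1)) (fun σ => T σ (k σ))

/-- The support `S_i` of the tensor product B-spline `B_i`. -/
def suppBox (n : Fin 2 → ℕ) (T : Fin 2 → ℤ → ℝ) (i : Fin 2 → ℤ) : Set Plane :=
  Set.Icc (fun σ => T σ (i σ)) (fun σ => T σ (i σ + n σ))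

/-- The unbounded extension `W_{σ,i}` of `S_i` in direction `σ`. -/
def strip (n : Fin 2 → ℕ) (T : Fin 2 → ℤ → ℝ) (σ : Fin 2) (i : Fin 2 → ℤ) : Set Plane :=
  {x | ∀ ρ, ρ ≠ σ → x ρ ∈ Set.Icc (T ρ (i ρ)) (T ρ (i ρ + n ρ))}

/-- An index `j = (i, γ)`: a grid index and a subset of the plane. -/
abbrev Index : Type := (Fin 2 → ℤ) × Set Plane

/-- The indices `j = (i, γ)`, `γ` a connected component of `S_i ∩ Ω`, of the diversified
B-splines; `γ` is the support `S_j = S_j^*` in `Ω`. -/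
def indexSet (Ω : Set Plane) (n : Fin 2 → ℕ) (T : Fin 2 → ℤ → ℝ) : Set Index :=
  {j | j.2 ∈ components Ω (suppBox n T j.1)}

/-- `W_{σ,j}`: the connected component of `W_{σ,i} ∩ Ω` that contains `S_j`. -/
def stripComponent (Ω : Set Plane) (n : Fin 2 → ℕ) (T : Fin 2 → ℤ → ℝ) (j : Index) (σ : Fin 2) :
    Set Plane :=
  componentOf Ω (strip n T σ j.1) j.2

/-- Lower end of the interval `ω_{σ,j}`, the `σ`-side of the bounding box of `W_{σ,j}`. -/
def omegaLo (Ω : Set Plane) (n : Fin 2 → ℕ) (T : Fin 2 → ℤ → ℝ) (j : Index) (σ : Fin 2) : ℝ :=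
  lower (stripComponent Ω n T j σ) σ

/-- Upper end of the interval `ω_{σ,j}`. -/
def omegaHi (Ω : Set Plane) (n : Fin 2 → ℕ) (T : Fin 2 → ℤ → ℝ) (j : Index) (σ : Fin 2) : ℝ :=
  upper (stripComponent Ω n T j σ) σ

/-- The condensed knots `T_j^*`: `T_σ` condensed with respect to `ω_{σ,j}`. -/
def condKnots (Ω : Set Plane) (n : Fin 2 → ℕ) (T : Fin 2 → ℤ → ℝ) (j : Index) (σ : Fin 2) :
    ℤ → ℝ :=
  condense (T σ) (omegaLo Ω n T j σ) (omegaHi Ω n T j σ)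

/-- The grid width `h_j^*` of the condensed knots. -/
def condWidth (Ω : Set Plane) (n : Fin 2 → ℕ) (T : Fin 2 → ℤ → ℝ) (j : Index) : Plane :=
  fun σ => maxGap (condKnots Ω n T j σ)

/-- The condensed diversified B-spline `B_j^*`. -/
def cdB (Ω : Set Plane) (n : Fin 2 → ℕ) (T : Fin 2 → ℤ → ℝ) (j : Index) : Plane → ℝ :=
  j.2.indicator fun x => ∏ σ, bspline (condKnots Ω n T j σ) (n σ) (j.1 σ) (x σ)

/-- The functional `P_j` that represents polynomials in terms of cdB-splines. -/
def P (Ω : Set Plane) (n : Fin 2 → ℕ) (T : Fin 2 → ℤ → ℝ) (j : Index) (q : Plane → ℝ) : ℝ :=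
  ∑ m₁ : Fin (n 0), ∑ m₂ : Fin (n 1),
    weight (n 0) (condKnots Ω n T j 0) (j.1 0) m₁ *
    weight (n 1) (condKnots Ω n T j 1) (j.1 1) m₂ *
    q ![evalPt (n 0) (condKnots Ω n T j 0) (j.1 0) m₁,
        evalPt (n 1) (condKnots Ω n T j 1) (j.1 1) m₂]

/-- `S_j^+`, the local `h_j^*`-neighbourhood of `S_j^*` in `Ω`. -/
def localNbhd (Ω : Set Plane) (n : Fin 2 → ℕ) (T : Fin 2 → ℤ → ℝ) (j : Index) : Set Plane :=
  componentOf Ω (nbhd j.2 (condWidth Ω n T j)) j.2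

/-- `H` is an admissible choice of the box `H_j^*`. It is attached to the lower or to the upper
edge of `S_i` in direction `σ` and extends from there by `h_{σ,j}^*` away from `S_i`; in the other
direction `1 - σ` it is an interval `I ⊆ ω_{1-σ,j}` of length `h_{1-σ,j}^*` (with or without its end
points); it contains a point `x` of `S_j^*` on that edge, and `H ⊆ S_j^+`. -/
def IsLocalBox (Ω : Set Plane) (n : Fin 2 → ℕ) (T : Fin 2 → ℤ → ℝ) (j : Index)
    (H : Set Plane) : Prop :=
  ∃ (σ : Fin 2) (e : ℝ) (V : Set ℝ) (lo : ℝ) (I : Set ℝ) (x : Plane),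
    ((e = T σ (j.1 σ) ∧ V = Set.Icc (e - condWidth Ω n T j σ) e) ∨
      (e = T σ (j.1 σ + n σ) ∧ V = Set.Icc e (e + condWidth Ω n T j σ))) ∧
    Set.Ioo lo (lo + condWidth Ω n T j (1 - σ)) ⊆ I ∧
    I ⊆ Set.Icc lo (lo + condWidth Ω n T j (1 - σ)) ∧
    I ⊆ Set.Ioo (omegaLo Ω n T j (1 - σ)) (omegaHi Ω n T j (1 - σ)) ∧
    x ∈ j.2 ∧ x σ = e ∧ x (1 - σ) ∈ I ∧
    H = {y | y σ ∈ V ∧ y (1 - σ) ∈ I} ∧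
    H ⊆ localNbhd Ω n T j

/-- The normalised tensor product Legendre polynomial of coordinate degree `(d₁, d₂)` over the
box `H`. -/
def tensorLegendre (H : Set Plane) (d₁ d₂ : ℕ) (x : Plane) : ℝ :=
  legendre (lower H 0) (upper H 0) d₁ (x 0) * legendre (lower H 1) (upper H 1) d₂ (x 1)

/-- The local approximation: the `L²(H)`-orthogonal projection of `f` onto the polynomials of
coordinate order `n`, by means of the Legendre polynomials over `H`. -/
def A (n : Fin 2 → ℕ) (H : Set Plane) (f : Plane → ℝ) (x : Plane) : ℝ :=
  ∑ d₁ ∈ Finset.range (n 0), ∑ d₂ ∈ Finset.range (n 1),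
    (∫ y in H, f y * tensorLegendre H d₁ d₂ y) * tensorLegendre H d₁ d₂ x

/-- The quasi-interpolant `Q f = ∑_j B_j^* P_j (A_j f)` for the boxes `H j`. -/
def Q (Ω : Set Plane) (n : Fin 2 → ℕ) (T : Fin 2 → ℤ → ℝ) (H : Index → Set Plane)
    (f : Plane → ℝ) (x : Plane) : ℝ :=
  ∑ᶠ j ∈ indexSet Ω n T, cdB Ω n T j x * P Ω n T j (A n (H j) f)

/-- `J_ℓ`: the indices of the cdB-splines that are relevant for the component `Γ` of a grid cell,
i.e. those whose support overlaps `Γ` (not just in boundary points of the cell). -/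
def relevant (Ω : Set Plane) (n : Fin 2 → ℕ) (T : Fin 2 → ℤ → ℝ) (Γ : Set Plane) : Set Index :=
  {j | j ∈ indexSet Ω n T ∧ (interior (j.2 ∩ Γ)).Nonempty}

end Bivariate

end CdSpline

end

/-! Polynomial reproduction combines a univariate fact with a geometric one. Univariate: the weights
are made so that the functional of index i sends (· - y)^(m-1) to ψ_i(y). By Marsden's identity
these functionals then recover every polynomial of degree < m from the m B-splines alive on a knot
interval (`sum_bspline_mul_functional`). Geometric: the condensed knots in one direction depend only
on the point x and on the index in the other direction (`condKnots_congr`). Moreover, some chart of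
Ω has x at height more than h₀ above its base, so in the direction of that chart the strip
components are too long for condensation (`condKnots_eq_of_chart`). At x one therefore sums first
over the index transverse to the chart. For a fixed index along the chart all transverse knots
coincide, and univariate reproduction applies. What remains is a univariate sum for the original
knots. The A_j reproduce polynomials because they are Legendre projections, and Qq = q follows.

Stability is a matter of scaling. The weights are bounded in terms of the order (`abs_weight_le`).
The box H_j^* has side lengths h_j^*, contains a point of the support and hence is within a bounded
multiple of h_j^* of every evaluation point. Extrapolating the Legendre projection thus costs only a
constant: |P_j A_j f| |H_j^*|^(1/p) ≤ c ‖f‖ (`enorm_P_A_mul_volume_rpow_le`). A component Γ of a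
cell fits into a box with sides at most h_j^*, so |Γ| ≤ |H_j^*| (`volume_component_le`). At an inner
point of Γ only n₁n₂ indices can contribute, all of them relevant, and integrating the pointwise
bound over Γ finishes the estimate.

For the existence of boxes, start from a point x of γ and descend in a chart to the edge of S_i that
faces the base. The height of x exceeds h₀ = (n̄+1)g, where g is the admitted spacing. The descent
uses at most n̄g, and a layer of thickness g is left for the box (`exists_isLocalBox`). Sideways,
the graph may stay above the level of the edge all the way to one end of the chart; this gives room
h₀. Otherwise it falls to that level on both sides of x and, not being part of Ω, traps the strip
component, so that every interval inside ω lies below the graph (`stripComponent_subset_of_graph`,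
`exists_interval_below_graph`). -/

namespace CdSpline

/-! ## Univariate B-splines -/

section BSpline

variable {t : ℤ → ℝ}

theorem bspline_support (ht : Monotone t) : ∀ {m : ℕ} {i : ℤ} {x : ℝ}, bspline t m i x ≠ 0 →
    t i ≤ x ∧ x < t (i + m)
  | 0, _, _, h => by simp [bspline] at h
  | 1, i, x, h => by
    rw [bspline] at h
    have := Set.mem_of_indicator_ne_zero h
    simpa using this
  | m + 2, i, x, h => by
    rw [bspline] at h
    by_cases h1 : bspline t (m + 1) i x = 0
    · have h2 : bspline t (m + 1) (i + 1) x ≠ 0 := by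
        rintro h2; simp [h1, h2] at h
      obtain ⟨h3, h4⟩ := bspline_support ht h2
      refine ⟨(ht (by lia)).trans h3, h4.trans_le (ht (by push_cast; lia))⟩
    · obtain ⟨h3, h4⟩ := bspline_support ht h1
      exact ⟨h3, h4.trans_le (ht (by push_cast; lia))⟩

theorem bspline_eq_zero_of_lt (ht : Monotone t) {m : ℕ} {i : ℤ} {x : ℝ} (h : x < t i) :
    bspline t m i x = 0 := by
  by_contra hb
  exact absurd (bspline_support ht hb).1 h.not_ge

theorem bspline_eq_zero_of_le (ht : Monotone t) {m : ℕ} {i : ℤ} {x : ℝ} (h : t (i + m) ≤ x) :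
    bspline t m i x = 0 := by
  by_contra hb
  exact absurd (bspline_support ht hb).2 h.not_gt

/-- On the support of each lower-order B-spline its quotient in the recursion lies in [0,1], so each
step at most doubles the bound. The sharp bound 1 is not needed. -/
theorem abs_bspline_le (ht : Monotone t) : ∀ (m : ℕ) (i : ℤ) (x : ℝ),
    |bspline t m i x| ≤ 2 ^ m
  | 0, _, _ => by simp [bspline]
  | 1, i, x => by
    rw [bspline]
    by_cases h : x ∈ Set.Ico (t i) (t (i + 1)) <;> simp [h]
  | m + 2, i, x => by
    have key : ∀ (c b : ℝ), (b ≠ 0 → |c| ≤ 1) → |b| ≤ 2 ^ (m + 1) → |c * b| ≤ 2 ^ (m + 1) := by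
      intro c b hc hb
      by_cases h : b = 0
      · simp [h]
      · rw [abs_mul]
        exact (mul_le_of_le_one_left (abs_nonneg _) (hc h)).trans hb
    rw [bspline]
    have h1 : |(x - t i) / (t (i + (m + 1)) - t i) * bspline t (m + 1) i x| ≤ 2 ^ (m + 1) := by
      refine key _ _ (fun h => ?_) (abs_bspline_le ht _ _ _)
      obtain ⟨h3, h4⟩ := bspline_support ht h
      push_cast at h4
      rw [abs_of_nonneg (div_nonneg (by linarith) (by linarith))]
      exact div_le_one_of_le₀ (by linarith) (by linarith)
    have h2 : |(t (i + (m + 2)) - x) / (t (i + (m + 2)) - t (i + 1)) *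
        bspline t (m + 1) (i + 1) x| ≤ 2 ^ (m + 1) := by
      refine key _ _ (fun h => ?_) (abs_bspline_le ht _ _ _)
      obtain ⟨h3, h4⟩ := bspline_support ht h
      push_cast at h4
      rw [show i + 1 + ((m : ℤ) + 1) = i + (m + 2) by ring] at h4
      rw [abs_of_nonneg (div_nonneg (by linarith) (by linarith))]
      exact div_le_one_of_le₀ (by linarith) (by linarith)
    calc _ ≤ _ := abs_add_le _ _
      _ ≤ 2 ^ (m + 1) + 2 ^ (m + 1) := add_le_add h1 h2
      _ = 2 ^ (m + 2) := by ring

/-- Dropping the last factor of ψ_i, or the first factor of ψ_(i-1), leaves the same product. This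
matches the two halves of the recursion in Marsden's identity. -/
theorem psi_succ_eq_mul_last (m : ℕ) (t : ℤ → ℝ) (i : ℤ) (y : ℝ) :
    psi (m + 2) t i y = psi (m + 1) t i y * (t (i + (m + 1)) - y) := by
  simp [psi, Finset.prod_range_succ, add_assoc]

theorem psi_succ_eq_first_mul (m : ℕ) (t : ℤ → ℝ) (i : ℤ) (y : ℝ) :
    psi (m + 2) t (i - 1) y = (t i - y) * psi (m + 1) t i y := by
  simp only [psi, show m + 2 - 1 = m + 1 by lia, show m + 1 - 1 = m by lia,
    Finset.prod_range_succ']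
  rw [mul_comm]
  congr 1
  · simp
  · refine Finset.prod_congr rfl fun r _ => ?_
    congr 2; push_cast; ring

/-- Marsden's identity on a nonempty knot interval. -/
theorem marsden (ht : Monotone t) {k : ℤ} {x : ℝ} (h1 : t k ≤ x) (h2 : x < t (k + 1)) (y : ℝ) :
    ∀ m : ℕ, ∑ s ∈ Finset.range (m + 1),
      psi (m + 1) t (k - s) y * bspline t (m + 1) (k - s) x = (x - y) ^ m
  | 0 => by
    simp [psi, bspline, h1, h2]
  | m + 1 => by
    have ih := marsden ht h1 h2 y m
    have e : ∀ s : ℕ, psi (m + 2) t (k - s) y * bspline t (m + 2) (k - s) x =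
        psi (m + 2) t (k - s) y * ((x - t (k - s)) / (t (k - s + (m + 1)) - t (k - s)) *
          bspline t (m + 1) (k - s) x) +
        psi (m + 2) t (k - s) y * ((t (k - s + (m + 2)) - x) /
          (t (k - s + (m + 2)) - t (k - s + 1)) * bspline t (m + 1) (k - s + 1) x) := by
      intro s; rw [bspline]; ring
    simp only [show m + 1 + 1 = m + 2 from rfl, e, Finset.sum_add_distrib]
    rw [Finset.sum_range_succ, Finset.sum_range_succ' _ (m + 1)]
    -- The two outermost B-splines of lower order vanish on the knot interval, so after an index
    -- shift both sums run over the same m + 1 indices.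
    have z1 : bspline t (m + 1) (k - ((m + 1 : ℕ) : ℤ)) x = 0 := by
      apply bspline_eq_zero_of_le ht
      simpa using h1
    have z2 : bspline t (m + 1) (k - ((0 : ℕ) : ℤ) + 1) x = 0 := by
      apply bspline_eq_zero_of_lt ht
      simpa using h2
    rw [z1, z2, mul_zero, mul_zero, mul_zero, mul_zero, add_zero, add_zero,
      ← Finset.sum_add_distrib, pow_succ, ← ih, Finset.sum_mul]
    refine Finset.sum_congr rfl fun s hs => ?_
    have hs' : s < m + 1 := Finset.mem_range.1 hs
    have g1 : t (k - s) ≤ t k := ht (by lia)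
    have g2 : t (k + 1) ≤ t (k - s + (m + 1)) := ht (by lia)
    have g3 : t (k - s + (m + 1)) - t (k - s) ≠ 0 := by
      have : t (k - s) < t (k - s + (m + 1)) := by linarith
      linarith
    have e1 : k - ((s + 1 : ℕ) : ℤ) = (k - s) - 1 := by push_cast; ring
    -- With a = t_(k-s) and b = t_(k-s+m+1), the terms combine by (x - a)(b - y) + (b - x)(a - y) =
    -- (x - y)(b - a).
    rw [e1, psi_succ_eq_mul_last, psi_succ_eq_first_mul,
      show k - (s : ℤ) - 1 + (m + 2) = k - s + (m + 1) by ring, sub_add_cancel]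
    field_simp
    ring

end BSpline

/-! ## The dual functionals -/

section Functional

open Polynomial

/-- A linear functional that annihilates all shifted powers of degree `d` annihilates all
polynomials of degree at most `d`. -/
theorem eq_zero_of_shifted_pow (d : ℕ) (L : ℝ[X] →ₗ[ℝ] ℝ)
    (h : ∀ y : ℝ, L ((X - C y) ^ d) = 0) {q : ℝ[X]} (hq : q.natDegree ≤ d) : L q = 0 := by
  have hm : ∀ k ≤ d, L (X ^ k) = 0 := by
    -- `F` is L((X - y)^d) read as a polynomial in y. It vanishes identically, and its coefficient
    -- of y^(d-k) is a nonzero multiple of L(X^k).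
    let F : ℝ[X] := ∑ k ∈ Finset.range (d + 1),
      C (L (X ^ k) * (-1) ^ (d - k) * (d.choose k : ℝ)) * X ^ (d - k)
    have hF : F = 0 := by
      apply Polynomial.funext
      intro y
      rw [eval_zero, ← h y, sub_eq_add_neg, ← C_neg, add_pow, map_sum, eval_finsetSum]
      refine Finset.sum_congr rfl fun k _ => ?_
      rw [show (X : ℝ[X]) ^ k * C (-y) ^ (d - k) * (d.choose k : ℝ[X]) =
        ((-y) ^ (d - k) * (d.choose k : ℝ)) • X ^ k by
          rw [smul_eq_C_mul]; simp; ring]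
      rw [map_smul]
      simp only [eval_mul, eval_C, eval_pow, eval_X, smul_eq_mul]
      rw [neg_pow y]; ring
    intro k hk
    have hc := congrArg (fun p : ℝ[X] => p.coeff (d - k)) hF
    simp only [F, finsetSum_coeff, coeff_C_mul, coeff_X_pow, coeff_zero] at hc
    rw [Finset.sum_eq_single k] at hc
    · have h1 : (d.choose k : ℝ) ≠ 0 := by exact_mod_cast (Nat.choose_pos hk).ne'
      simpa [h1] using hc
    · intro b hb hbk
      have := Finset.mem_range.1 hb
      rw [if_neg (by lia), mul_zero]
    · intro hk'
      exact absurd (Finset.mem_range.2 (by lia)) hk'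
  rw [q.as_sum_range_C_mul_X_pow' (n := d + 1) (by lia), map_sum]
  refine Finset.sum_eq_zero fun k hk => ?_
  rw [← smul_eq_C_mul, map_smul, hm k (by have := Finset.mem_range.1 hk; lia), smul_zero]

/-- Two polynomials of degree `< m` agree if they agree in `m` points. -/
theorem eval_eq_of_eval_fin {m : ℕ} {p q : ℝ[X]} (hp : p.natDegree < m) (hq : q.natDegree < m)
    {v : Fin m → ℝ} (hv : Function.Injective v) (h : ∀ l, p.eval (v l) = q.eval (v l)) :
    p = q := by
  have hm : 0 < m := by lia
  refine eq_of_degrees_lt_of_eval_index_eq (s := Finset.univ) (v := v) (hv.injOn) ?_ ?_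
    fun l _ => h l
  · simpa using degree_le_natDegree.trans_lt (by exact_mod_cast hp)
  · simpa using degree_le_natDegree.trans_lt (by exact_mod_cast hq)

/-- The polynomial `y ↦ ∑ l, w l * (a l - y) ^ d` has degree at most `d`. -/
theorem natDegree_sum_shifted_pow_le {m : ℕ} (w a : Fin m → ℝ) (d : ℕ) :
    (∑ l, C (w l) * (C (a l) - X) ^ d : ℝ[X]).natDegree ≤ d := by
  refine natDegree_sum_le_of_forall_le _ _ fun l _ => ?_
  refine (natDegree_C_mul_le _ _).trans (natDegree_pow_le.trans ?_)
  have : (C (a l) - X : ℝ[X]).natDegree ≤ 1 :=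
    (natDegree_sub_le _ _).trans (by simp)
  nlinarith

/-- The functional `q ↦ ∑ l, w l * q (a l)`. -/
noncomputable def pointFunctional {m : ℕ} (w a : Fin m → ℝ) : ℝ[X] →ₗ[ℝ] ℝ :=
  ∑ l, w l • (Polynomial.leval (a l))

theorem pointFunctional_apply {m : ℕ} (w a : Fin m → ℝ) (q : ℝ[X]) :
    pointFunctional w a q = ∑ l, w l * q.eval (a l) := by
  simp [pointFunctional, Polynomial.leval]

/-- A kernel vector w makes the polynomial y ↦ ∑ w_l (l - y)^(m-1) vanish at 0, …, m-1, hence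
identically. Then w annihilates all powers of degree < m at these nodes and is zero by the
Vandermonde argument. -/
theorem weightMatrix_det_ne_zero (m : ℕ) :
    (Matrix.of fun l l' : Fin m => ((l' : ℝ) - (l : ℝ)) ^ (m - 1)).det ≠ 0 := by
  rcases Nat.eq_zero_or_pos m with rfl | hm
  · simp
  intro hdet
  obtain ⟨w, hw0, hw⟩ := Matrix.exists_mulVec_eq_zero_iff.2 hdet
  apply hw0
  have hinj : Function.Injective (fun l : Fin m => (l : ℝ)) := by
    intro a b hab
    exact Fin.ext (by simpa using hab)
  have hp : (∑ l, C (w l) * (C (l : ℝ) - X) ^ (m - 1) : ℝ[X]) = 0 := by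
    refine eval_eq_of_eval_fin (m := m) ?_ (by simpa using hm) hinj fun l => ?_
    · exact (natDegree_sum_shifted_pow_le w _ _).trans_lt (by lia)
    · have := congrFun hw l
      simp only [Matrix.mulVec, dotProduct, Matrix.of_apply, Pi.zero_apply] at this
      simp only [eval_finsetSum, eval_mul, eval_C, eval_pow, eval_sub, eval_X, eval_zero]
      rw [← this]
      exact Finset.sum_congr rfl fun _ _ => mul_comm _ _
  have hz : ∀ k < m, ∑ l, w l * (l : ℝ) ^ k = 0 := by
    intro k hk
    have := eq_zero_of_shifted_pow (m - 1) (pointFunctional w fun l => (l : ℝ)) (fun y => ?_)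
      (q := X ^ k) (by rw [natDegree_X_pow]; lia)
    · simpa [pointFunctional_apply] using this
    · have := congrArg (eval y) hp
      simpa [pointFunctional_apply, eval_finsetSum] using this
  exact Matrix.eq_zero_of_forall_pow_sum_mul_pow_eq_zero hinj fun k => hz k k.2

theorem longest_spec {m : ℕ} (hm : 0 < m) (t : ℤ → ℝ) (i : ℤ) :
    longest m t i < m ∧ ∀ K' : ℕ, K' < m →
      t (i + K' + 1) - t (i + K') ≤ longLen m t i := by
  have : ∃ K : ℕ, K < m ∧ ∀ K' : ℕ, K' < m →
      t (i + K' + 1) - t (i + K') ≤ t (i + K + 1) - t (i + K) := by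
    obtain ⟨K, hK, hmax⟩ := Finset.exists_max_image (Finset.range m)
      (fun K : ℕ => t (i + K + 1) - t (i + K)) ⟨0, by simpa using hm⟩
    exact ⟨K, by simpa using hK, fun K' hK' => hmax K' (by simpa using hK')⟩
  exact Classical.epsilon_spec this

theorem longLen_nonneg {t : ℤ → ℝ} (ht : Monotone t) (m : ℕ) (i : ℤ) : 0 ≤ longLen m t i :=
  sub_nonneg.2 (ht (by lia))

/-- The support consists of m knot intervals, none longer than the longest one. Hence it is
comparable with |I|, however nonuniform the knots are. -/
theorem support_length_le {m : ℕ} (hm : 0 < m) (t : ℤ → ℝ) (i : ℤ) :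
    t (i + m) - t i ≤ m * longLen m t i := by
  have h : ∀ k ≤ m, t (i + k) - t i ≤ k * longLen m t i := by
    intro k hk
    induction k with
    | zero => simp
    | succ k ih =>
      have h1 := ih (by lia)
      have h2 := (longest_spec hm t i).2 k (by lia)
      push_cast
      rw [← add_assoc]
      linarith
  exact h m le_rfl

theorem longLen_pos {m : ℕ} (hm : 0 < m) {t : ℤ → ℝ} {i : ℤ} (h : t i < t (i + m)) :
    0 < longLen m t i := by
  have h1 := support_length_le hm t i
  have h2 : (0 : ℝ) < m := by exact_mod_cast hm
  by_contra h3
  nlinarith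

theorem evalPt_mem {m : ℕ} {t : ℤ → ℝ} (ht : Monotone t) (i : ℤ) (l : Fin m) :
    evalPt m t i l ∈ Set.Icc (t i) (t (i + m)) := by
  have hm : 0 < m := l.pos
  -- For m = 1 the quotient is 0 / 0 = 0, and the point is the left end point.
  have hl : (l : ℝ) / ((m : ℝ) - 1) ≤ 1 := by
    apply div_le_one_of_le₀
    · have : ((l : ℕ) : ℝ) + 1 ≤ m := by exact_mod_cast l.2
      linarith
    · have : (1 : ℝ) ≤ m := by exact_mod_cast hm
      linarith
  have hl0 : 0 ≤ (l : ℝ) / ((m : ℝ) - 1) := by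
    apply div_nonneg (by positivity)
    have : (1 : ℝ) ≤ m := by exact_mod_cast hm
    linarith
  have hK := (longest_spec hm t i).1
  have h0 := longLen_nonneg ht m i
  have h1 : t i ≤ longLeft m t i := ht (by lia)
  have h2 : longLeft m t i + longLen m t i ≤ t (i + m) := by
    rw [longLeft, longLen, add_sub_cancel]
    exact ht (by lia)
  rw [evalPt]
  constructor
  · nlinarith
  · nlinarith

theorem evalPt_injective {m : ℕ} {t : ℤ → ℝ} {i : ℤ} (hpos : 0 < longLen m t i) :
    Function.Injective (evalPt m t i) := by
  intro a b hab
  rcases Nat.lt_or_ge 1 m with hm | hm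
  · have h1 : (0 : ℝ) < (m : ℝ) - 1 := by
      have : (1 : ℝ) < m := by exact_mod_cast hm
      linarith
    simp only [evalPt, add_right_inj] at hab
    have h2 := mul_right_cancel₀ hpos.ne' hab
    rw [div_left_inj' h1.ne'] at h2
    exact Fin.ext (by exact_mod_cast h2)
  · exact Fin.ext (by lia)

/-- The functional with the weights `weight` maps `(· - y) ^ (m - 1)` to `psi y`. -/
theorem sum_weight_mul_shifted_pow {m : ℕ} (hm : 0 < m) {t : ℤ → ℝ} {i : ℤ}
    (hpos : 0 < longLen m t i) (y : ℝ) :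
    ∑ l, weight m t i l * (evalPt m t i l - y) ^ (m - 1) = psi m t i y := by
  set M : Matrix (Fin m) (Fin m) ℝ :=
    Matrix.of fun l l' : Fin m => ((l' : ℝ) - (l : ℝ)) ^ (m - 1) with hM
  have hsolve : M.mulVec (weight m t i) = fun l => ((m : ℝ) - 1) ^ (m - 1) /
      longLen m t i ^ (m - 1) * psi m t i (evalPt m t i l) := by
    rw [weight, ← hM, Matrix.mulVec_mulVec, Matrix.mul_nonsing_inv, Matrix.one_mulVec]
    exact isUnit_iff_ne_zero.2 (weightMatrix_det_ne_zero m)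
  -- As polynomials in y both sides have degree < m, and the linear system says that they agree at
  -- the m evaluation points.
  have heq : (∑ l, C (weight m t i l) * (C (evalPt m t i l) - X) ^ (m - 1) : ℝ[X]) =
      ∏ r ∈ Finset.range (m - 1), (C (t (i + r + 1)) - X) := by
    refine eval_eq_of_eval_fin (m := m) ?_ ?_ (evalPt_injective hpos) fun l => ?_
    · exact (natDegree_sum_shifted_pow_le _ _ _).trans_lt (by lia)
    · refine (natDegree_prod_le _ _).trans_lt ?_
      refine (Finset.sum_le_card_nsmul _ _ 1 fun r _ => ?_).trans_lt ?_
      · exact (natDegree_sub_le _ _).trans (by simp)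
      · simp; lia
    · have h1 := congrFun hsolve l
      simp only [Matrix.mulVec, dotProduct, hM, Matrix.of_apply] at h1
      simp only [eval_finsetSum, eval_mul, eval_C, eval_pow, eval_sub, eval_X, eval_prod]
      change _ = psi m t i (evalPt m t i l)
      have h2 : ∀ l' : Fin m, evalPt m t i l' - evalPt m t i l =
          ((l' : ℝ) - l) * (longLen m t i / ((m : ℝ) - 1)) := by
        intro l'; simp only [evalPt]; ring
      simp only [h2, mul_pow]
      rcases Nat.lt_or_ge 1 m with hm1 | hm1
      · have h3 : (m : ℝ) - 1 ≠ 0 := by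
          have : (1 : ℝ) < m := by exact_mod_cast hm1
          linarith
        rw [show (∑ l' : Fin m, weight m t i l' * (((l' : ℝ) - l) ^ (m - 1) *
          (longLen m t i / ((m : ℝ) - 1)) ^ (m - 1))) =
          (∑ l' : Fin m, ((l' : ℝ) - l) ^ (m - 1) * weight m t i l') *
          (longLen m t i / ((m : ℝ) - 1)) ^ (m - 1) by
            rw [Finset.sum_mul]; exact Finset.sum_congr rfl fun _ _ => by ring]
        rw [h1, div_pow]
        have := hpos.ne'
        field_simp
      -- For order one the factor m - 1 is zero, but it occurs only to the power 0.
      · obtain rfl : m = 1 := by lia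
        simpa using h1
  have := congrArg (eval y) heq
  simpa [eval_finsetSum, eval_prod, psi] using this

/-- Reproduction of univariate polynomials on a nonempty knot interval. -/
theorem sum_bspline_mul_functional {t : ℤ → ℝ} (ht : Monotone t) {m : ℕ} (hm : 0 < m) {k : ℤ}
    {x : ℝ} (h1 : t k ≤ x) (h2 : x < t (k + 1)) {q : ℝ[X]} (hq : q.natDegree < m) :
    ∑ s ∈ Finset.range m, bspline t m (k - s) x *
      ∑ l, weight m t (k - s) l * q.eval (evalPt m t (k - s) l) = q.eval x := by
  obtain ⟨d, rfl⟩ : ∃ d, m = d + 1 := ⟨m - 1, by lia⟩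
  -- `L` is the reproduction error at x; Marsden's identity says that it annihilates all shifted
  -- powers of degree d.
  let L : ℝ[X] →ₗ[ℝ] ℝ := ∑ s ∈ Finset.range (d + 1), bspline t (d + 1) (k - s) x •
      pointFunctional (weight (d + 1) t (k - s)) (evalPt (d + 1) t (k - s)) - leval x
  have hL : ∀ p, L p = ∑ s ∈ Finset.range (d + 1), bspline t (d + 1) (k - s) x *
      (∑ l, weight (d + 1) t (k - s) l * p.eval (evalPt (d + 1) t (k - s) l)) - p.eval x := by
    intro p
    simp [L, pointFunctional_apply, leval]
  have h := eq_zero_of_shifted_pow d L (fun y => ?_) (q := q) (by lia)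
  · rw [hL] at h; linarith
  · rw [hL, ← sub_eq_zero.2 (marsden ht h1 h2 y d)]
    simp only [eval_pow, eval_sub, eval_X, eval_C]
    congr 1
    refine Finset.sum_congr rfl fun s hs => ?_
    have hs' := Finset.mem_range.1 hs
    have hpos : 0 < longLen (d + 1) t (k - s) := by
      apply longLen_pos (by lia)
      calc t (k - s) ≤ t k := ht (by lia)
        _ < t (k + 1) := by linarith
        _ ≤ _ := ht (by push_cast; lia)
    rw [← sum_weight_mul_shifted_pow (by lia) hpos y, add_tsub_cancel_right]
    ring

/-- A bound for the weights, depending only on the order. -/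
noncomputable def weightBound (m : ℕ) : ℝ :=
  (∑ l, ∑ l', |(Matrix.of fun l l' : Fin m => ((l' : ℝ) - (l : ℝ)) ^ (m - 1))⁻¹ l l'|) *
    (((m : ℝ) - 1) ^ (m - 1) * m ^ (m - 1))

/-- Each of the m - 1 factors of ψ at an evaluation point is at most m|I|, which cancels |I|^(m-1)
in the right-hand side. The inverse matrix depends on m only. -/
theorem abs_weight_le {m : ℕ} {t : ℤ → ℝ} (ht : Monotone t) (i : ℤ) (l : Fin m) :
    |weight m t i l| ≤ weightBound m := by
  have hm : 0 < m := l.pos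
  have hm1 : (0 : ℝ) ≤ (m : ℝ) - 1 := by
    have : (1 : ℝ) ≤ m := by exact_mod_cast hm
    linarith
  set N := (Matrix.of fun l l' : Fin m => ((l' : ℝ) - (l : ℝ)) ^ (m - 1))⁻¹ with hN
  have hpsi : ∀ l', |((m : ℝ) - 1) ^ (m - 1) / longLen m t i ^ (m - 1) *
      psi m t i (evalPt m t i l')| ≤ ((m : ℝ) - 1) ^ (m - 1) * m ^ (m - 1) := by
    intro l'
    have h0 := longLen_nonneg ht m i
    have h1 : |psi m t i (evalPt m t i l')| ≤ (m * longLen m t i) ^ (m - 1) := by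
      rw [psi, Finset.abs_prod]
      refine (Finset.prod_le_prod (g := fun _ => m * longLen m t i) (fun _ _ => abs_nonneg _)
        fun r hr => ?_).trans (by simp)
      have hr' := Finset.mem_range.1 hr
      have h2 := evalPt_mem ht i l'
      have h3 := support_length_le hm t i
      have h4 : t i ≤ t (i + r + 1) := ht (by lia)
      have h5 : t (i + r + 1) ≤ t (i + m) := ht (by lia)
      rw [abs_le]
      constructor <;> linarith [h2.1, h2.2]
    rw [abs_mul, abs_of_nonneg (by positivity)]
    calc _ ≤ ((m : ℝ) - 1) ^ (m - 1) / longLen m t i ^ (m - 1) *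
        (m * longLen m t i) ^ (m - 1) := by gcongr
      _ = ((m : ℝ) - 1) ^ (m - 1) * m ^ (m - 1) *
        (longLen m t i ^ (m - 1) / longLen m t i ^ (m - 1)) := by rw [mul_pow]; ring
      _ ≤ _ := mul_le_of_le_one_right (by positivity) (div_self_le_one _)
  calc |weight m t i l| ≤ ∑ l', |N l l'| * (((m : ℝ) - 1) ^ (m - 1) * m ^ (m - 1)) := by
        rw [weight, ← hN, Matrix.mulVec, dotProduct]
        refine (Finset.abs_sum_le_sum_abs _ _).trans (Finset.sum_le_sum fun l' _ => ?_)
        rw [abs_mul]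
        gcongr
        exact hpsi l'
    _ = (∑ l', |N l l'|) * (((m : ℝ) - 1) ^ (m - 1) * m ^ (m - 1)) := by rw [Finset.sum_mul]
    _ ≤ weightBound m := by
        rw [weightBound, ← hN]
        refine mul_le_mul_of_nonneg_right ?_ (by positivity)
        exact Finset.single_le_sum (f := fun l => ∑ l', |N l l'|)
          (fun _ _ => Finset.sum_nonneg fun _ _ => abs_nonneg _) (Finset.mem_univ l)

theorem weightBound_nonneg {m : ℕ} (hm : 0 < m) : 0 ≤ weightBound m :=
  (abs_nonneg _).trans (abs_weight_le (t := fun _ => 0) monotone_const 0 (⟨0, hm⟩ : Fin m))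

end Functional

/-! ## Legendre polynomials -/

section Legendre

open Polynomial

/-- The integral of a polynomial over the unit interval. -/
noncomputable def unitIntegral : ℝ[X] →ₗ[ℝ] ℝ where
  toFun p := ∫ x in (0 : ℝ)..1, p.eval x
  map_add' p q := by
    simp only [eval_add]
    exact intervalIntegral.integral_add (p.continuous.intervalIntegrable _ _)
      (q.continuous.intervalIntegrable _ _)
  map_smul' c p := by simp

theorem unitIntegral_apply (p : ℝ[X]) : unitIntegral p = ∫ x in (0 : ℝ)..1, p.eval x := rfl

theorem unitIntegral_derivative (p : ℝ[X]) :
    unitIntegral (derivative p) = p.eval 1 - p.eval 0 :=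
  intervalIntegral.integral_eq_sub_of_hasDerivAt (fun x _ => p.hasDerivAt x)
    ((derivative p).continuous.intervalIntegrable _ _)

theorem unitIntegral_mul_derivative (g v : ℝ[X]) (h0 : v.eval 0 = 0) (h1 : v.eval 1 = 0) :
    unitIntegral (g * derivative v) = -unitIntegral (derivative g * v) := by
  have h := unitIntegral_derivative (g * v)
  rw [derivative_mul, map_add, eval_mul, eval_mul, h0, h1] at h
  linarith

/-- Integration by parts, k times; the hypothesis removes all boundary terms. -/
theorem unitIntegral_mul_iterate_derivative (u : ℝ[X]) : ∀ (k : ℕ) (g : ℝ[X]),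
    (∀ i < k, (derivative^[i] u).eval 0 = 0 ∧ (derivative^[i] u).eval 1 = 0) →
    unitIntegral (g * derivative^[k] u) = (-1) ^ k * unitIntegral (derivative^[k] g * u)
  | 0, g, _ => by simp
  | k + 1, g, h => by
    rw [Function.iterate_succ_apply', unitIntegral_mul_derivative _ _ (h k (by lia)).1
      (h k (by lia)).2, unitIntegral_mul_iterate_derivative u k _ fun i hi => h i (by lia),
      Function.iterate_succ_apply, pow_succ]
    ring

/-- X^(a+1) (1 - X)^(b+1) vanishes at both end points, so the integral of its derivative is zero.
This trades a factor 1 - X for a factor X. -/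
theorem unitIntegral_beta : ∀ b a : ℕ, unitIntegral (X ^ a * (1 - X) ^ b) =
    (a.factorial * b.factorial : ℝ) / (a + b + 1).factorial
  | 0, a => by
    simp only [pow_zero, mul_one, unitIntegral_apply, eval_pow, eval_X, integral_pow]
    rw [add_zero, Nat.factorial_succ]
    have := Nat.factorial_pos a
    push_cast
    field_simp
    simp
  | b + 1, a => by
    have h := unitIntegral_derivative (X ^ (a + 1) * (1 - X) ^ (b + 1) : ℝ[X])
    have e : derivative (X ^ (a + 1) * (1 - X) ^ (b + 1) : ℝ[X]) =
        ((a : ℝ) + 1) • (X ^ a * (1 - X) ^ (b + 1)) -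
        ((b : ℝ) + 1) • (X ^ (a + 1) * (1 - X) ^ b) := by
      simp only [derivative_mul, derivative_pow, derivative_sub, derivative_one,
        derivative_X, smul_eq_C_mul]
      simp
      ring
    rw [e, map_sub, map_smul, map_smul, unitIntegral_beta b (a + 1)] at h
    simp only [smul_eq_mul, eval_mul, eval_pow, eval_sub, eval_one, eval_X, sub_self] at h
    rw [zero_pow (by lia), zero_pow (by lia), mul_zero, zero_mul, sub_self,
      Nat.factorial_succ a] at h
    rw [Nat.factorial_succ b, show a + (b + 1) + 1 = a + 1 + b + 1 by ring]
    have h3 : ((a : ℝ) + 1) ≠ 0 := by positivity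
    apply mul_left_cancel₀ h3
    have h4 := sub_eq_zero.1 h
    rw [h4]
    push_cast
    ring

/-- The shifted Legendre polynomial with real coefficients. -/
noncomputable def realLegendre (d : ℕ) : ℝ[X] := (shiftedLegendre d).map (Int.castRingHom ℝ)

theorem natDegree_realLegendre (d : ℕ) : (realLegendre d).natDegree = d := by
  rw [realLegendre, natDegree_map_eq_of_injective (RingHom.injective_int _),
    natDegree_shiftedLegendre]

theorem coeff_realLegendre_self (d : ℕ) :
    (realLegendre d).coeff d = (-1) ^ d * (d + d).choose d := by
  simp [realLegendre, coeff_shiftedLegendre]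

/-- Rodrigues' formula, the source of orthogonality and of the norm. -/
theorem factorial_smul_realLegendre (d : ℕ) : (d.factorial : ℝ) • realLegendre d =
    derivative^[d] (X ^ d * (1 - X) ^ d) := by
  have h := congrArg (Polynomial.map (Int.castRingHom ℝ)) (factorial_mul_shiftedLegendre_eq d)
  rw [← iterate_derivative_map] at h
  simpa [smul_eq_C_mul, realLegendre] using h

theorem unitIntegral_mul_realLegendre (d : ℕ) (g : ℝ[X]) :
    (d.factorial : ℝ) * unitIntegral (g * realLegendre d) =
    (-1) ^ d * unitIntegral (derivative^[d] g * (X ^ d * (1 - X) ^ d)) := by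
  rw [← unitIntegral_mul_iterate_derivative, ← factorial_smul_realLegendre, mul_smul_comm,
    map_smul, smul_eq_mul]
  intro i hi
  -- The d-fold zeros at 0 and 1 survive fewer than d differentiations.
  have hz : ∀ (p : ℝ[X]) (y : ℝ), p.eval y = 0 → p ^ d ∣ X ^ d * (1 - X : ℝ[X]) ^ d →
      (derivative^[i] (X ^ d * (1 - X) ^ d : ℝ[X])).eval y = 0 := by
    intro p y hy hp
    obtain ⟨r, hr⟩ := pow_sub_dvd_iterate_derivative_of_pow_dvd i hp
    rw [hr, eval_mul, eval_pow, hy, zero_pow (by lia), zero_mul]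
  exact ⟨hz X 0 (by simp) (Dvd.intro _ rfl), hz (1 - X) 1 (by simp) (Dvd.intro_left _ rfl)⟩

theorem unitIntegral_realLegendre_of_lt {d : ℕ} {g : ℝ[X]} (hg : g.natDegree < d) :
    unitIntegral (g * realLegendre d) = 0 := by
  have h := unitIntegral_mul_realLegendre d g
  rw [iterate_derivative_eq_zero hg, zero_mul, map_zero, mul_zero] at h
  exact (mul_eq_zero.1 h).resolve_left (by exact_mod_cast (Nat.factorial_pos d).ne')

/-- After d integrations by parts only the constant d! times the leading coefficient remains,
multiplied by a beta integral. -/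
theorem unitIntegral_realLegendre_self (d : ℕ) :
    (2 * (d : ℝ) + 1) * unitIntegral (realLegendre d * realLegendre d) = 1 := by
  have h := unitIntegral_mul_realLegendre d (realLegendre d)
  have e : derivative^[d] (realLegendre d) =
      C ((d.factorial : ℝ) * ((-1) ^ d * (d + d).choose d)) := by
    have hdeg : (derivative^[d] (realLegendre d)).natDegree = 0 := by
      have := natDegree_iterate_derivative (realLegendre d) d
      rw [natDegree_realLegendre] at this; lia
    rw [eq_C_of_natDegree_eq_zero hdeg, coeff_iterate_derivative, zero_add,
      coeff_realLegendre_self, Nat.descFactorial_self, nsmul_eq_mul]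
  rw [e, ← smul_eq_C_mul, map_smul, unitIntegral_beta, smul_eq_mul] at h
  have h2 : ((d + d).choose d : ℝ) * d.factorial * d.factorial = (d + d).factorial := by
    exact_mod_cast Nat.add_choose_mul_factorial_mul_factorial d d
  have h3 : ((d + d + 1).factorial : ℝ) = (2 * d + 1) * (d + d).factorial := by
    rw [Nat.factorial_succ]; push_cast; ring
  have h4 : ((-1 : ℝ) ^ d) * (-1) ^ d = 1 := by rw [← mul_pow]; simp
  have h5 : (d.factorial : ℝ) ≠ 0 := by exact_mod_cast (Nat.factorial_pos d).ne'
  have h6 : ((d + d).factorial : ℝ) ≠ 0 := by exact_mod_cast (Nat.factorial_pos _).ne'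
  have h7 : (2 * (d : ℝ) + 1) ≠ 0 := by positivity
  apply mul_left_cancel₀ h5
  calc _ = (2 * (d : ℝ) + 1) * ((d.factorial : ℝ) *
        unitIntegral (realLegendre d * realLegendre d)) := by ring
    _ = ((-1 : ℝ) ^ d * (-1) ^ d) * ((2 * (d : ℝ) + 1) * d.factorial *
        (((d + d).choose d : ℝ) * d.factorial * d.factorial) / (d + d + 1).factorial) := by
      rw [h]; ring
    _ = _ := by rw [h4, h2, h3]; field_simp

theorem unitIntegral_realLegendre_of_ne {d e : ℕ} (h : d ≠ e) :
    unitIntegral (realLegendre d * realLegendre e) = 0 := by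
  rcases h.lt_or_gt with h | h
  · exact unitIntegral_realLegendre_of_lt (by rwa [natDegree_realLegendre])
  · rw [mul_comm]
    exact unitIntegral_realLegendre_of_lt (by rwa [natDegree_realLegendre])

theorem exists_realLegendre_expansion : ∀ (n : ℕ) (q : ℝ[X]), q.degree < n →
    ∃ c : ℕ → ℝ, q = ∑ d ∈ Finset.range n, c d • realLegendre d
  | 0, q, h => ⟨0, by simpa [Nat.WithBot.lt_zero_iff] using h⟩
  | n + 1, q, h => by
    have hlead : (realLegendre n).coeff n ≠ 0 := by
      rw [coeff_realLegendre_self]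
      have := (Nat.choose_pos (show n ≤ n + n by lia)).ne'
      refine mul_ne_zero (by simp) (by exact_mod_cast this)
    set b := q.coeff n / (realLegendre n).coeff n with hb
    have hdeg : (q - b • realLegendre n).degree < n := by
      rw [degree_lt_iff_coeff_zero]
      intro k hk
      rw [coeff_sub, coeff_smul, smul_eq_mul]
      rcases hk.eq_or_lt with rfl | hk
      · rw [hb]; field_simp; simp
      · rw [coeff_eq_zero_of_natDegree_lt (p := realLegendre n)
          (by rwa [natDegree_realLegendre]), coeff_eq_zero_of_degree_lt]
        · simp
        · exact h.trans_le (by exact_mod_cast hk)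
    obtain ⟨c, hc⟩ := exists_realLegendre_expansion n _ hdeg
    refine ⟨Function.update c n b, ?_⟩
    rw [Finset.sum_range_succ, Function.update_self,
      Finset.sum_congr rfl fun d hd => ?_, ← hc, sub_add_cancel]
    rw [Function.update_of_ne (Finset.mem_range.1 hd).ne]

theorem realLegendre_projection {n : ℕ} {q : ℝ[X]} (hq : q.degree < n) :
    ∑ d ∈ Finset.range n,
      ((2 * (d : ℝ) + 1) * unitIntegral (q * realLegendre d)) • realLegendre d = q := by
  obtain ⟨c, rfl⟩ := exists_realLegendre_expansion n q hq
  refine Finset.sum_congr rfl fun d hd => ?_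
  congr 1
  rw [Finset.sum_mul, map_sum, Finset.sum_eq_single_of_mem d hd]
  · rw [smul_mul_assoc, map_smul, smul_eq_mul]
    linear_combination c d * unitIntegral_realLegendre_self d
  · intro e _ he
    rw [smul_mul_assoc, map_smul, unitIntegral_realLegendre_of_ne he, smul_zero]

theorem legendre_eq (lo hi : ℝ) (d : ℕ) (x : ℝ) : legendre lo hi d x =
    Real.sqrt ((2 * d + 1) / (hi - lo)) * (realLegendre d).eval ((x - lo) / (hi - lo)) := by
  rw [legendre, realLegendre, eval_map, aeval_def]
  rfl

theorem continuous_legendre (lo hi : ℝ) (d : ℕ) : Continuous (legendre lo hi d) := by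
  have : legendre lo hi d = fun x => Real.sqrt ((2 * d + 1) / (hi - lo)) *
      (realLegendre d).eval ((x - lo) / (hi - lo)) := funext (legendre_eq lo hi d)
  rw [this]
  exact continuous_const.mul ((realLegendre d).continuous.comp (by fun_prop))

/-- The interval `I` has end points `lo < hi`, which may or may not belong to it. -/
structure IsIntervalOf (I : Set ℝ) (lo hi : ℝ) : Prop where
  lt : lo < hi
  Ioo_subset : Set.Ioo lo hi ⊆ I
  subset_Icc : I ⊆ Set.Icc lo hi

theorem IsIntervalOf.ae_eq {I : Set ℝ} {lo hi : ℝ} (h : IsIntervalOf I lo hi) :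
    I =ᵐ[volume] Set.Ioc lo hi := by
  have h1 : Set.Ioo lo hi =ᵐ[volume] Set.Ioc lo hi := Ioo_ae_eq_Ioc
  have h2 : Set.Ioc lo hi =ᵐ[volume] Set.Icc lo hi := Ioc_ae_eq_Icc
  exact Filter.EventuallyLE.antisymm
    (h.subset_Icc.eventuallyLE.trans h2.symm.le)
    (h1.symm.le.trans h.Ioo_subset.eventuallyLE)

theorem IsIntervalOf.setIntegral_eq {I : Set ℝ} {lo hi : ℝ} (h : IsIntervalOf I lo hi)
    (f : ℝ → ℝ) : ∫ x in I, f x = ∫ x in lo..hi, f x := by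
  rw [intervalIntegral.integral_of_le h.lt.le, setIntegral_congr_set h.ae_eq]

theorem IsIntervalOf.volume_eq {I : Set ℝ} {lo hi : ℝ} (h : IsIntervalOf I lo hi) :
    volume I = ENNReal.ofReal (hi - lo) := by
  rw [measure_congr h.ae_eq, Real.volume_Ioc]

/-- The univariate Legendre projection reproduces polynomials. -/
theorem legendre_projection {I : Set ℝ} {lo hi : ℝ} (h : IsIntervalOf I lo hi) {n : ℕ}
    {q : ℝ[X]} (hq : q.natDegree < n) (x : ℝ) :
    ∑ d ∈ Finset.range n, (∫ y in I, q.eval y * legendre lo hi d y) * legendre lo hi d x =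
      q.eval x := by
  have hw : 0 < hi - lo := sub_pos.2 h.lt
  set r : ℝ[X] := q.comp (C lo + C (hi - lo) * X) with hr
  have hrq : ∀ y, q.eval y = r.eval ((y - lo) / (hi - lo)) := by
    intro y
    rw [hr, eval_comp]
    congr 1
    simp only [eval_add, eval_C, eval_mul, eval_X]
    field_simp
    ring
  have hrdeg : r.degree < n := by
    refine degree_le_natDegree.trans_lt ?_
    have h1 : r.natDegree ≤ q.natDegree * 1 := by
      refine natDegree_comp_le.trans (Nat.mul_le_mul_left _ ?_)
      exact (natDegree_add_le _ _).trans (max_le (by simp)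
        ((natDegree_C_mul_le _ _).trans natDegree_X_le))
    exact_mod_cast (by lia : r.natDegree < n)
  have hint : ∀ d, ∫ y in I, q.eval y * legendre lo hi d y =
      Real.sqrt ((2 * d + 1) / (hi - lo)) * ((hi - lo) * unitIntegral (r * realLegendre d)) := by
    intro d
    rw [h.setIntegral_eq]
    have : ∀ y, q.eval y * legendre lo hi d y = (fun u => Real.sqrt ((2 * d + 1) / (hi - lo)) *
        (r * realLegendre d).eval u) (y / (hi - lo) - lo / (hi - lo)) := by
      intro y
      simp only [legendre_eq, hrq, eval_mul, sub_div]
      ring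
    simp only [this]
    rw [intervalIntegral.integral_comp_div_sub (fun u => Real.sqrt ((2 * d + 1) / (hi - lo)) *
        (r * realLegendre d).eval u) hw.ne', sub_self, ← sub_div, div_self hw.ne',
      intervalIntegral.integral_const_mul, unitIntegral_apply, smul_eq_mul]
    ring
  rw [hrq x]
  conv_rhs => rw [← realLegendre_projection hrdeg, eval_finsetSum]
  refine Finset.sum_congr rfl fun d _ => ?_
  rw [hint, legendre_eq, eval_smul, smul_eq_mul]
  have h1 : Real.sqrt ((2 * d + 1) / (hi - lo)) * Real.sqrt ((2 * d + 1) / (hi - lo)) *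
      (hi - lo) = 2 * d + 1 := by
    rw [Real.mul_self_sqrt (by positivity), div_mul_cancel₀ _ hw.ne']
  linear_combination unitIntegral (r * realLegendre d) *
    (realLegendre d).eval ((x - lo) / (hi - lo)) * h1

/-- A bound for `legendre lo hi d`, times the square root of the length of the interval, at points
of distance at most `M * (hi - lo)` from `lo`. -/
noncomputable def legendreBound (d : ℕ) (M : ℝ) : ℝ :=
  Real.sqrt (2 * d + 1) * ∑ k ∈ Finset.range (d + 1), |(realLegendre d).coeff k| * M ^ k

theorem legendreBound_nonneg (d : ℕ) {M : ℝ} (hM : 0 ≤ M) : 0 ≤ legendreBound d M := by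
  unfold legendreBound; positivity

/-- In the variable rescaled to the unit interval, x has modulus at most M. The normalisation
contributes the inverse square root of the length. -/
theorem abs_legendre_le {lo hi : ℝ} (h : lo < hi) (d : ℕ) {x M : ℝ}
    (hx : |x - lo| ≤ M * (hi - lo)) :
    |legendre lo hi d x| ≤ legendreBound d M / Real.sqrt (hi - lo) := by
  have hw : 0 < hi - lo := sub_pos.2 h
  have hu : |(x - lo) / (hi - lo)| ≤ M := by
    rw [abs_div, abs_of_pos hw]
    exact (div_le_iff₀ hw).2 hx
  rw [legendre_eq, abs_mul, abs_of_nonneg (Real.sqrt_nonneg _), Real.sqrt_div (by positivity),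
    legendreBound, mul_div_right_comm]
  gcongr
  rw [eval_eq_sum_range, natDegree_realLegendre]
  refine (Finset.abs_sum_le_sum_abs _ _).trans (Finset.sum_le_sum fun k _ => ?_)
  rw [abs_mul, abs_pow]
  gcongr

end Legendre

/-! ## The local projections -/

section Projection

open Polynomial

theorem IsIntervalOf.nonempty {I : Set ℝ} {lo hi : ℝ} (h : IsIntervalOf I lo hi) : I.Nonempty :=
  (Set.nonempty_Ioo.2 h.lt).mono h.Ioo_subset

theorem IsIntervalOf.csInf_eq {I : Set ℝ} {lo hi : ℝ} (h : IsIntervalOf I lo hi) :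
    sInf I = lo := by
  apply le_antisymm
  · rw [← csInf_Ioo h.lt]
    exact csInf_le_csInf (bddBelow_Icc.mono h.subset_Icc) (Set.nonempty_Ioo.2 h.lt) h.Ioo_subset
  · exact le_csInf h.nonempty fun y hy => (h.subset_Icc hy).1

theorem IsIntervalOf.csSup_eq {I : Set ℝ} {lo hi : ℝ} (h : IsIntervalOf I lo hi) :
    sSup I = hi := by
  apply le_antisymm
  · exact csSup_le h.nonempty fun y hy => (h.subset_Icc hy).2
  · rw [← csSup_Ioo h.lt]
    exact csSup_le_csSup (bddAbove_Icc.mono h.subset_Icc) (Set.nonempty_Ioo.2 h.lt) h.Ioo_subset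

/-- The set `H` is an axis-parallel box with corners `lo` and `hi`. -/
def IsBox (H : Set Plane) (lo hi : Plane) : Prop :=
  ∃ s : Fin 2 → Set ℝ, H = Set.univ.pi s ∧ ∀ ρ, IsIntervalOf (s ρ) (lo ρ) (hi ρ)

variable {H : Set Plane} {lo hi : Plane}

theorem IsBox.lower_eq (h : IsBox H lo hi) : lower H = lo := by
  obtain ⟨s, rfl, hs⟩ := h
  funext σ
  rw [lower, Set.eval_image_univ_pi (Set.univ_pi_nonempty_iff.2 fun ρ => (hs ρ).nonempty),
    (hs σ).csInf_eq]

theorem IsBox.upper_eq (h : IsBox H lo hi) : upper H = hi := by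
  obtain ⟨s, rfl, hs⟩ := h
  funext σ
  rw [upper, Set.eval_image_univ_pi (Set.univ_pi_nonempty_iff.2 fun ρ => (hs ρ).nonempty),
    (hs σ).csSup_eq]

theorem IsBox.lt (h : IsBox H lo hi) (ρ : Fin 2) : lo ρ < hi ρ := by
  obtain ⟨s, -, hs⟩ := h
  exact (hs ρ).lt

theorem IsBox.subset_Icc (h : IsBox H lo hi) : H ⊆ Set.Icc lo hi := by
  obtain ⟨s, rfl, hs⟩ := h
  intro y hy
  exact ⟨fun ρ => ((hs ρ).subset_Icc (hy ρ trivial)).1,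
    fun ρ => ((hs ρ).subset_Icc (hy ρ trivial)).2⟩

theorem IsBox.volume_eq (h : IsBox H lo hi) :
    volume H = ENNReal.ofReal ((hi 0 - lo 0) * (hi 1 - lo 1)) := by
  obtain ⟨s, rfl, hs⟩ := h
  rw [volume_pi_pi, Fin.prod_univ_two, (hs 0).volume_eq, (hs 1).volume_eq,
    ENNReal.ofReal_mul (sub_pos.2 (hs 0).lt).le]

theorem IsBox.measurableSet_ae (h : IsBox H lo hi) : NullMeasurableSet H := by
  obtain ⟨s, rfl, hs⟩ := h
  exact (MeasurableSet.univ_pi fun ρ => measurableSet_Ioc).nullMeasurableSet.congr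
    (Measure.ae_eq_set_pi fun ρ _ => (hs ρ).ae_eq.symm)

theorem IsBox.ae_mem (h : IsBox H lo hi) : ∀ᵐ y ∂(volume.restrict H), y ∈ Set.Icc lo hi :=
  (ae_restrict_mem₀ h.measurableSet_ae).mono fun _ hy => h.subset_Icc hy

theorem IsBox.integrableOn (h : IsBox H lo hi) {f : Plane → ℝ} (hf : Continuous f) :
    IntegrableOn f H :=
  (hf.integrableOn_Icc).mono_set h.subset_Icc

theorem continuous_tensorLegendre (H : Set Plane) (d₁ d₂ : ℕ) :
    Continuous (tensorLegendre H d₁ d₂) := by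
  unfold tensorLegendre
  exact ((continuous_legendre _ _ _).comp (continuous_apply 0)).mul
    ((continuous_legendre _ _ _).comp (continuous_apply 1))

theorem A_sum (h : IsBox H lo hi) (n : Fin 2 → ℕ) {ι : Type*} (S : Finset ι) (c : ι → ℝ)
    (F : ι → Plane → ℝ) (hF : ∀ s ∈ S, Continuous (F s)) (x : Plane) :
    A n H (fun y => ∑ s ∈ S, c s * F s y) x = ∑ s ∈ S, c s * A n H (F s) x := by
  unfold A
  have hint : ∀ d₁ d₂, ∫ y in H, (∑ s ∈ S, c s * F s y) * tensorLegendre H d₁ d₂ y =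
      ∑ s ∈ S, c s * ∫ y in H, F s y * tensorLegendre H d₁ d₂ y := by
    intro d₁ d₂
    simp only [Finset.sum_mul]
    rw [integral_finsetSum]
    · refine Finset.sum_congr rfl fun s _ => ?_
      rw [← integral_const_mul]
      exact integral_congr_ae (ae_of_all _ fun y => mul_assoc _ _ _)
    · intro s hs
      exact h.integrableOn ((continuous_const.mul (hF s hs)).mul
        (continuous_tensorLegendre H d₁ d₂))
  simp_rw [hint, Finset.sum_mul, Finset.mul_sum]
  symm
  rw [Finset.sum_comm]
  refine Finset.sum_congr rfl fun d₁ _ => ?_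
  rw [Finset.sum_comm]
  simp only [mul_assoc]

/-- By Fubini the Legendre coefficients of a product are products, so the bivariate projection
factors into two univariate ones. -/
theorem A_tensor (h : IsBox H lo hi) (n : Fin 2 → ℕ) (q : Fin 2 → ℝ[X])
    (hq : ∀ σ, (q σ).natDegree < n σ) (x : Plane) :
    A n H (fun y => (q 0).eval (y 0) * (q 1).eval (y 1)) x =
      (q 0).eval (x 0) * (q 1).eval (x 1) := by
  have hlo := h.lower_eq
  have hhi := h.upper_eq
  obtain ⟨s, rfl, hs⟩ := h
  unfold A tensorLegendre
  rw [hlo, hhi]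
  have hint : ∀ d₁ d₂, ∫ y in Set.univ.pi s, (q 0).eval (y 0) * (q 1).eval (y 1) *
      (legendre (lo 0) (hi 0) d₁ (y 0) * legendre (lo 1) (hi 1) d₂ (y 1)) =
      (∫ y in s 0, (q 0).eval y * legendre (lo 0) (hi 0) d₁ y) *
      ∫ y in s 1, (q 1).eval y * legendre (lo 1) (hi 1) d₂ y := by
    intro d₁ d₂
    rw [volume_pi, Measure.restrict_pi_pi]
    have := integral_fintype_prod_eq_prod (μ := fun i => volume.restrict (s i)) (𝕜 := ℝ)
      (fun (i : Fin 2) (y : ℝ) => (q i).eval y * legendre (lo i) (hi i) (![d₁, d₂] i) y)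
    simp only [Fin.prod_univ_two, Matrix.cons_val_zero, Matrix.cons_val_one] at this
    rw [← this]
    exact integral_congr_ae (ae_of_all _ fun y => by ring)
  simp only [hint]
  rw [← legendre_projection (hs 0) (hq 0) (x 0), ← legendre_projection (hs 1) (hq 1) (x 1),
    Finset.sum_mul_sum]
  refine Finset.sum_congr rfl fun d₁ _ => Finset.sum_congr rfl fun d₂ _ => ?_
  ring

theorem eval_eq_sum_tensor (q : MvPolynomial (Fin 2) ℝ) (y : Plane) :
    MvPolynomial.eval y q = ∑ s ∈ q.support, q.coeff s *
      ((X ^ s 0 : ℝ[X]).eval (y 0) * (X ^ s 1 : ℝ[X]).eval (y 1)) := by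
  rw [MvPolynomial.eval_eq']
  simp [Fin.prod_univ_two]

theorem natDegree_of_mem_support {n : Fin 2 → ℕ} {q : MvPolynomial (Fin 2) ℝ}
    (hq : ∀ σ, q.degreeOf σ < n σ) {s : Fin 2 →₀ ℕ} (hs : s ∈ q.support) (σ : Fin 2) :
    (X ^ s σ : ℝ[X]).natDegree < n σ := by
  rw [natDegree_X_pow]
  exact (MvPolynomial.degreeOf_le_iff.1 le_rfl s hs).trans_lt (hq σ)

/-- The local projections reproduce polynomials. -/
theorem A_mvPolynomial (h : IsBox H lo hi) (n : Fin 2 → ℕ) (q : MvPolynomial (Fin 2) ℝ)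
    (hq : ∀ σ, q.degreeOf σ < n σ) (x : Plane) :
    A n H (fun y => MvPolynomial.eval y q) x = MvPolynomial.eval x q := by
  simp only [eval_eq_sum_tensor]
  refine (A_sum h n q.support (fun s => q.coeff s) (fun s y =>
    (X ^ s 0 : ℝ[X]).eval (y 0) * (X ^ s 1 : ℝ[X]).eval (y 1)) ?_ x).trans ?_
  rotate_left
  · refine Finset.sum_congr rfl fun s hs => ?_
    rw [A_tensor h n (fun σ => X ^ s σ) (natDegree_of_mem_support hq hs)]
  · intro s _
    exact ((X ^ s 0 : ℝ[X]).continuous.comp (continuous_apply 0)).mul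
      ((X ^ s 1 : ℝ[X]).continuous.comp (continuous_apply 1))

/-- The stability constant of the local projections at points of distance at most `M` times the
side lengths from the corner of the box. -/
noncomputable def projectionBound (n : Fin 2 → ℕ) (M : ℝ) : ℝ :=
  ∑ d₁ ∈ Finset.range (n 0), ∑ d₂ ∈ Finset.range (n 1),
    (legendreBound d₁ 1 * legendreBound d₂ 1) * (legendreBound d₁ M * legendreBound d₂ M)

theorem projectionBound_nonneg (n : Fin 2 → ℕ) {M : ℝ} (hM : 0 ≤ M) :
    0 ≤ projectionBound n M := by
  refine Finset.sum_nonneg fun d₁ _ => Finset.sum_nonneg fun d₂ _ => ?_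
  have := legendreBound_nonneg d₁ hM
  have := legendreBound_nonneg d₂ hM
  have := legendreBound_nonneg d₁ zero_le_one
  have := legendreBound_nonneg d₂ zero_le_one
  positivity

theorem abs_tensorLegendre_le (h : IsBox H lo hi) (d₁ d₂ : ℕ) {x : Plane} {M : ℝ} (hM : 0 ≤ M)
    (hx : ∀ ρ, |x ρ - lo ρ| ≤ M * (hi ρ - lo ρ)) :
    |tensorLegendre H d₁ d₂ x| ≤ legendreBound d₁ M * legendreBound d₂ M /
      Real.sqrt ((hi 0 - lo 0) * (hi 1 - lo 1)) := by
  rw [tensorLegendre, h.lower_eq, h.upper_eq, abs_mul, Real.sqrt_mul (sub_pos.2 (h.lt 0)).le,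
    mul_div_mul_comm]
  have := legendreBound_nonneg d₁ hM
  exact mul_le_mul (abs_legendre_le (h.lt 0) d₁ (hx 0)) (abs_legendre_le (h.lt 1) d₂ (hx 1))
    (abs_nonneg _) (by positivity)

/-- The L¹ estimate: the Legendre polynomial under the integral and the one outside each carry
|H|^(-1/2). The resulting 1/|H| is moved to the left-hand side. -/
theorem enorm_A_le (h : IsBox H lo hi) (n : Fin 2 → ℕ) (f : Plane → ℝ) {x : Plane} {M : ℝ}
    (hM : 0 ≤ M) (hx : ∀ ρ, |x ρ - lo ρ| ≤ M * (hi ρ - lo ρ)) :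
    ‖A n H f x‖ₑ * volume H ≤
      ENNReal.ofReal (projectionBound n M) * eLpNorm f 1 (volume.restrict H) := by
  have hv : 0 < (hi 0 - lo 0) * (hi 1 - lo 1) :=
    mul_pos (sub_pos.2 (h.lt 0)) (sub_pos.2 (h.lt 1))
  set v := (hi 0 - lo 0) * (hi 1 - lo 1) with hvdef
  have hK : ∀ d (M : ℝ), 0 ≤ M → 0 ≤ legendreBound d M := fun d M => legendreBound_nonneg d
  have hterm : ∀ d₁ d₂, ‖(∫ y in H, f y * tensorLegendre H d₁ d₂ y) * tensorLegendre H d₁ d₂ x‖ₑ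
      ≤ ENNReal.ofReal ((legendreBound d₁ 1 * legendreBound d₂ 1) *
        (legendreBound d₁ M * legendreBound d₂ M) / v) * eLpNorm f 1 (volume.restrict H) := by
    intro d₁ d₂
    have h1 : ‖∫ y in H, f y * tensorLegendre H d₁ d₂ y‖ₑ ≤
        ENNReal.ofReal (legendreBound d₁ 1 * legendreBound d₂ 1 / Real.sqrt v) *
        eLpNorm f 1 (volume.restrict H) := by
      refine (enorm_integral_le_lintegral_enorm _).trans ?_
      rw [eLpNorm_one_eq_lintegral_enorm, ← lintegral_const_mul' _ _ ENNReal.ofReal_ne_top]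
      refine lintegral_mono_ae ?_
      filter_upwards [h.ae_mem] with y hy
      rw [enorm_mul, mul_comm]
      gcongr
      rw [Real.enorm_eq_ofReal_abs]
      apply ENNReal.ofReal_le_ofReal
      refine abs_tensorLegendre_le h d₁ d₂ zero_le_one fun ρ => ?_
      have h3 := hy.1 ρ
      have h4 := hy.2 ρ
      rw [abs_of_nonneg (by linarith)]
      linarith
    have h2 : ‖tensorLegendre H d₁ d₂ x‖ₑ ≤
        ENNReal.ofReal (legendreBound d₁ M * legendreBound d₂ M / Real.sqrt v) := by
      rw [Real.enorm_eq_ofReal_abs]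
      exact ENNReal.ofReal_le_ofReal (abs_tensorLegendre_le h d₁ d₂ hM hx)
    rw [enorm_mul]
    refine (mul_le_mul' h1 h2).trans_eq ?_
    rw [mul_right_comm, ← ENNReal.ofReal_mul]
    · congr 2
      rw [div_mul_div_comm, Real.mul_self_sqrt hv.le]
    · have := hK d₁ 1 zero_le_one
      have := hK d₂ 1 zero_le_one
      positivity
  have hsum : ‖A n H f x‖ₑ ≤ ENNReal.ofReal (projectionBound n M / v) *
      eLpNorm f 1 (volume.restrict H) := by
    have hpos : ∀ d₁ d₂, 0 ≤ (legendreBound d₁ 1 * legendreBound d₂ 1) *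
        (legendreBound d₁ M * legendreBound d₂ M) / v := by
      intro d₁ d₂
      have := hK d₁ 1 zero_le_one
      have := hK d₂ 1 zero_le_one
      have := hK d₁ M hM
      have := hK d₂ M hM
      positivity
    rw [projectionBound, Finset.sum_div, ENNReal.ofReal_sum_of_nonneg, Finset.sum_mul]
    · refine (enorm_sum_le _ _).trans (Finset.sum_le_sum fun d₁ _ => ?_)
      rw [Finset.sum_div, ENNReal.ofReal_sum_of_nonneg fun d₂ _ => hpos d₁ d₂, Finset.sum_mul]
      exact (enorm_sum_le _ _).trans (Finset.sum_le_sum fun d₂ _ => hterm d₁ d₂)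
    · intro d₁ _
      rw [Finset.sum_div]
      exact Finset.sum_nonneg fun d₂ _ => hpos d₁ d₂
  calc _ ≤ ENNReal.ofReal (projectionBound n M / v) * eLpNorm f 1 (volume.restrict H) *
        volume H := by gcongr
    _ = _ := by
      rw [h.volume_eq, mul_right_comm, ← ENNReal.ofReal_mul
        (div_nonneg (projectionBound_nonneg n hM) hv.le), div_mul_cancel₀ _ hv.ne']

/-- Stability of the local projections. -/
theorem enorm_A_mul_volume_rpow_le (h : IsBox H lo hi) (n : Fin 2 → ℕ) {p : ℝ≥0∞} (hp : 1 ≤ p)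
    {f : Plane → ℝ} (hf : AEStronglyMeasurable f (volume.restrict H)) {x : Plane} {M : ℝ}
    (hM : 0 ≤ M) (hx : ∀ ρ, |x ρ - lo ρ| ≤ M * (hi ρ - lo ρ)) :
    ‖A n H f x‖ₑ * volume H ^ (1 / p.toReal) ≤
      ENNReal.ofReal (projectionBound n M) * eLpNorm f p (volume.restrict H) := by
  have hv0 : volume H ≠ 0 := by
    rw [h.volume_eq]
    have := mul_pos (sub_pos.2 (h.lt 0)) (sub_pos.2 (h.lt 1))
    simpa using this
  have hvt : volume H ≠ ∞ := by rw [h.volume_eq]; exact ENNReal.ofReal_ne_top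
  have h1 := enorm_A_le h n f hM hx
  -- Hölder turns the L¹ norm into the L^p norm times |H|^(1 - 1/p), a finite nonzero factor that is
  -- cancelled. For p = ∞ the exponent 1 / `p.toReal` is 1 / 0 = 0, as it should be.
  have h2 := eLpNorm_le_eLpNorm_mul_rpow_measure_univ (μ := volume.restrict H) hp hf
  rw [Measure.restrict_apply_univ, ENNReal.toReal_one, div_one] at h2
  have h3 : volume H ^ (1 - 1 / p.toReal) * volume H ^ (1 / p.toReal) = volume H := by
    rw [← ENNReal.rpow_add _ _ hv0 hvt, sub_add_cancel, ENNReal.rpow_one]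
  have h4 : volume H ^ (1 - 1 / p.toReal) ≠ 0 := by
    simp [ENNReal.rpow_eq_zero_iff, hv0, hvt]
  have h5 : volume H ^ (1 - 1 / p.toReal) ≠ ∞ := by
    simp [ENNReal.rpow_eq_top_iff, hv0, hvt]
  rw [← ENNReal.mul_le_mul_iff_left h4 h5]
  calc _ = ‖A n H f x‖ₑ * volume H := by rw [mul_assoc, mul_comm (_ ^ (1 / p.toReal)), h3]
    _ ≤ _ := h1
    _ ≤ ENNReal.ofReal (projectionBound n M) *
        (eLpNorm f p (volume.restrict H) * volume H ^ (1 - 1 / p.toReal)) := by gcongr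
    _ = _ := by rw [mul_assoc]

end Projection

/-! ## Condensed knots -/

section Condense

variable {t : ℤ → ℝ} {lo hi : ℝ}

theorem le_maxGap {g : ℝ} (hg : ∀ k, t (k + 1) - t k ≤ g) (k : ℤ) :
    t (k + 1) - t k ≤ maxGap t :=
  le_ciSup (f := fun k : ℤ => t (k + 1) - t k) ⟨g, by rintro _ ⟨k, rfl⟩; exact hg k⟩ k

theorem maxGap_le {g : ℝ} (hg : ∀ k, t (k + 1) - t k ≤ g) : maxGap t ≤ g := ciSup_le hg

theorem condense_monotone (ht : Monotone t) (lo hi : ℝ) : Monotone (condense t lo hi) := by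
  intro a b hab
  unfold condense
  split_ifs
  · exact max_le_max le_rfl (min_le_min le_rfl (ht hab))
  · exact ht hab

theorem condense_eq_of_lt (h : maxGap t < hi - lo) : condense t lo hi = t := by
  funext k
  rw [condense, if_neg h.not_ge]

/-- Clamping to an interval is monotone and does not increase distances. -/
theorem condense_gap_le (ht : Monotone t) (lo hi : ℝ) (k : ℤ) :
    condense t lo hi (k + 1) - condense t lo hi k ≤ t (k + 1) - t k := by
  have := ht (show k ≤ k + 1 by lia)
  unfold condense
  split_ifs
  · rcases max_cases lo (min hi (t (k + 1))) with h1 | h1 <;>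
    rcases max_cases lo (min hi (t k)) with h2 | h2 <;>
    rcases min_cases hi (t (k + 1)) with h3 | h3 <;>
    rcases min_cases hi (t k) with h4 | h4 <;> linarith
  · exact le_rfl

/-- Condensation does not move a knot past a point of ω. Thus the knot interval of such a point has
the same index before and after condensation. -/
theorem condense_le_iff {x : ℝ} (hx : x ∈ Set.Ioo lo hi) (k : ℤ) :
    condense t lo hi k ≤ x ↔ t k ≤ x := by
  unfold condense
  split_ifs
  · simp [hx.1.le, hx.2.not_ge]
  · rfl

theorem le_condense_iff {x : ℝ} (hx : x ∈ Set.Ioo lo hi) (k : ℤ) :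
    x ≤ condense t lo hi k ↔ x ≤ t k := by
  unfold condense
  split_ifs
  · simp [hx.2.le, hx.1.not_ge]
  · rfl

theorem maxGap_condense_le (ht : Monotone t) {g : ℝ} (hg : ∀ k, t (k + 1) - t k ≤ g) :
    maxGap (condense t lo hi) ≤ maxGap t :=
  maxGap_le fun k => (condense_gap_le ht lo hi k).trans (le_maxGap hg k)

/-- Either all condensed knots lie between the end points of ω, or nothing is condensed because the
spacing is already smaller than |ω|. This guarantees room in ω for a side of length h*. -/
theorem maxGap_condense_le_sub (h : lo ≤ hi) : maxGap (condense t lo hi) ≤ hi - lo := by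
  rcases lt_or_ge (maxGap t) (hi - lo) with h1 | h1
  · rw [condense_eq_of_lt h1]
    exact h1.le
  · refine maxGap_le fun k => ?_
    unfold condense
    rw [if_pos h1, if_pos h1]
    have h2 : max lo (min hi (t (k + 1))) ≤ hi := max_le h (min_le_left _ _)
    have h3 : lo ≤ max lo (min hi (t k)) := le_max_left _ _
    linarith

theorem le_maxGap_condense (ht : Monotone t) {g : ℝ} (hg : ∀ k, t (k + 1) - t k ≤ g) (k : ℤ) :
    condense t lo hi (k + 1) - condense t lo hi k ≤ maxGap (condense t lo hi) :=
  le_maxGap (fun k => (condense_gap_le ht lo hi k).trans (hg k)) k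

theorem maxGap_condense_pos (ht : Monotone t) {g : ℝ} (hg : ∀ k, t (k + 1) - t k ≤ g) {x : ℝ}
    (hx : x ∈ Set.Ioo lo hi) {k : ℤ} (h1 : t k ≤ x) (h2 : x < t (k + 1)) :
    0 < maxGap (condense t lo hi) := by
  refine lt_of_lt_of_le ?_ (le_maxGap_condense ht hg k)
  have h3 := (condense_le_iff hx k).2 h1
  have h4 := not_le.1 (mt (condense_le_iff hx (k + 1)).1 h2.not_ge)
  linarith

/-- Two points of ω in a common knot interval stay in a common condensed one. This bounds the extent
of a cell component by h*, not merely by h. -/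
theorem sub_le_maxGap_condense (ht : Monotone t) {g : ℝ} (hg : ∀ k, t (k + 1) - t k ≤ g)
    {x y : ℝ} (hx : x ∈ Set.Ioo lo hi) (hy : y ∈ Set.Ioo lo hi) {k : ℤ} (h1 : t k ≤ x)
    (h2 : y ≤ t (k + 1)) : y - x ≤ maxGap (condense t lo hi) := by
  refine le_trans ?_ (le_maxGap_condense ht hg k)
  have h3 := (condense_le_iff hx k).2 h1
  have h4 := (le_condense_iff hy (k + 1)).2 h2
  linarith

theorem sub_le_mul_of_gap_le {g : ℝ} (hg : ∀ k, t (k + 1) - t k ≤ g) (i : ℤ) (m : ℕ) :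
    t (i + m) - t i ≤ m * g := by
  induction m with
  | zero => simp
  | succ m ih =>
    have := hg (i + m)
    push_cast
    rw [← add_assoc]
    linarith

end Condense

/-! ## Connected components -/

section Components

variable {Ω M γ Z : Set Plane} {x : Plane}

theorem isPreconnected_box (σ : Fin 2) {V I : Set ℝ} (hV : V.OrdConnected) (hI : I.OrdConnected) :
    IsPreconnected {y : Plane | y σ ∈ V ∧ y (1 - σ) ∈ I} :=
  ((hV.convex.is_linear_preimage (f := fun y : Plane => y σ) ⟨fun _ _ => rfl, fun _ _ => rfl⟩).inter
    (hI.convex.is_linear_preimage (f := fun y : Plane => y (1 - σ))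
      ⟨fun _ _ => rfl, fun _ _ => rfl⟩)).isPreconnected

theorem components_isPreconnected (h : γ ∈ components Ω M) : IsPreconnected γ := by
  obtain ⟨x, -, rfl⟩ := h
  exact isPreconnected_connectedComponentIn

theorem components_subset (h : γ ∈ components Ω M) : γ ⊆ M ∩ Ω := by
  obtain ⟨x, -, rfl⟩ := h
  exact connectedComponentIn_subset _ _

theorem components_nonempty (h : γ ∈ components Ω M) : γ.Nonempty := by
  obtain ⟨x, hx, rfl⟩ := h
  exact ⟨x, mem_connectedComponentIn hx⟩

theorem components_eq (h : γ ∈ components Ω M) (hx : x ∈ γ) :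
    γ = connectedComponentIn (M ∩ Ω) x := by
  obtain ⟨z, -, rfl⟩ := h
  exact connectedComponentIn_eq hx

theorem subset_of_mem_components (h : γ ∈ components Ω M) (hZ : IsPreconnected Z)
    (hZs : Z ⊆ M ∩ Ω) (hxZ : x ∈ Z) (hx : x ∈ γ) : Z ⊆ γ := by
  rw [components_eq h hx]
  exact hZ.subset_connectedComponentIn hxZ hZs

theorem componentOf_eq (hγ : IsPreconnected γ) (hγs : γ ⊆ M ∩ Ω) (hx : x ∈ γ) :
    componentOf Ω M γ = connectedComponentIn (M ∩ Ω) x := by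
  ext y
  constructor
  · rintro ⟨z, hz, hy⟩
    have hzx : z ∈ connectedComponentIn (M ∩ Ω) x := hγ.subset_connectedComponentIn hx hγs hz
    rwa [connectedComponentIn_eq hzx]
  · intro hy
    exact ⟨x, hx, hy⟩

theorem componentOf_subset : componentOf Ω M γ ⊆ M ∩ Ω := by
  rintro y ⟨z, -, hy⟩
  exact connectedComponentIn_subset _ _ hy

theorem subset_componentOf (hZ : IsPreconnected Z) (hZs : Z ⊆ M ∩ Ω) (hxZ : x ∈ Z)
    (hx : x ∈ γ) : Z ⊆ componentOf Ω M γ :=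
  fun _ hy => ⟨x, hx, hZ.subset_connectedComponentIn hxZ hZs hy⟩

theorem subset_componentOf_of_mem (hZ : IsPreconnected Z) (hZs : Z ⊆ M ∩ Ω) (hxZ : x ∈ Z)
    (hx : x ∈ componentOf Ω M γ) : Z ⊆ componentOf Ω M γ := by
  obtain ⟨z, hz, hxz⟩ := hx
  refine fun y hy => ⟨z, hz, ?_⟩
  rw [connectedComponentIn_eq hxz]
  exact hZ.subset_connectedComponentIn hxZ hZs hy

end Components

/-! ## Graph domains -/

section GraphDomain

/-- A multiple of a quarter turn permutes the coordinate axes up to signs. Here σ is the image of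
the vertical direction of the model region. -/
theorem quarterTurn_iterate (k : ℕ) : ∃ (σ : Fin 2) (s s' : ℝ), (s = 1 ∨ s = -1) ∧
    (s' = 1 ∨ s' = -1) ∧ ∀ y : Plane, (quarterTurn^[k] y) σ = s * y 1 ∧
      (quarterTurn^[k] y) (1 - σ) = s' * y 0 := by
  induction k with
  | zero => exact ⟨1, 1, 1, by simp, by simp, fun y => by simp⟩
  | succ k ih =>
    obtain ⟨σ, s, s', hs, hs', h⟩ := ih
    fin_cases σ
    · refine ⟨1, s, -s', hs, by rcases hs' with rfl | rfl <;> simp, fun y => ?_⟩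
      obtain ⟨h1, h2⟩ := h y
      rw [Function.iterate_succ_apply']
      simp at h1 h2
      simp [quarterTurn, h1, h2]
    · refine ⟨0, -s, s', by rcases hs with rfl | rfl <;> simp, hs', fun y => ?_⟩
      obtain ⟨h1, h2⟩ := h y
      rw [Function.iterate_succ_apply']
      simp at h1 h2
      simp [quarterTurn, h1, h2]

theorem plane_ext (σ : Fin 2) {x y : Plane} (h1 : x σ = y σ) (h2 : x (1 - σ) = y (1 - σ)) :
    x = y := by
  funext ρ
  fin_cases σ <;> fin_cases ρ <;> simp_all

/-- The point with given coordinates in direction `σ` and in the other direction. -/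
def planeMk (σ : Fin 2) (v u : ℝ) : Plane := Function.update (fun _ => u) σ v

@[simp]
theorem planeMk_same (σ : Fin 2) (v u : ℝ) : planeMk σ v u σ = v := by simp [planeMk]

@[simp]
theorem planeMk_other (σ : Fin 2) (v u : ℝ) : planeMk σ v u (1 - σ) = u := by
  fin_cases σ <;> simp [planeMk]

theorem axisIsometry_eq_iff (k : ℕ) (v : Plane) : ∃ (σ : Fin 2) (s s' : ℝ), (s = 1 ∨ s = -1) ∧
    (s' = 1 ∨ s' = -1) ∧ ∀ x y : Plane, axisIsometry k v y = x ↔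
      y 0 = s' * (x (1 - σ) - v (1 - σ)) ∧ y 1 = s * (x σ - v σ) := by
  obtain ⟨σ, s, s', hs, hs', h⟩ := quarterTurn_iterate k
  refine ⟨σ, s, s', hs, hs', fun x y => ?_⟩
  obtain ⟨h1, h2⟩ := h y
  have hss : s * s = 1 := by rcases hs with rfl | rfl <;> simp
  have hss' : s' * s' = 1 := by rcases hs' with rfl | rfl <;> simp
  constructor
  · rintro rfl
    simp only [axisIsometry, Pi.add_apply, h1, h2, add_sub_cancel_right, ← mul_assoc, hss, hss',
      one_mul, and_self]
  · rintro ⟨h3, h4⟩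
    apply plane_ext σ
    · simp only [axisIsometry, Pi.add_apply, h1, h4, ← mul_assoc, hss]; ring
    · simp only [axisIsometry, Pi.add_apply, h2, h3, ← mul_assoc, hss']; ring

/-- In the direction `σ`, with orientation `s`, the set `Ω` is locally, near `x`, the region below
the graph of `ψ`. -/
structure IsChart (Ω : Set Plane) (h₀ : ℝ) (x : Plane) (σ : Fin 2) (s a b c : ℝ) (ψ : ℝ → ℝ) :
    Prop where
  sign : s = 1 ∨ s = -1
  lt_a : h₀ < a
  continuousOn : ContinuousOn ψ (Set.Icc (c - a) (c + a))
  mem_Icc : x (1 - σ) ∈ Set.Icc (c - a + h₀) (c + a - h₀)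
  lt_height : h₀ < s * (x σ - b)
  height_lt : s * (x σ - b) < ψ (x (1 - σ))
  mem : ∀ y : Plane, y (1 - σ) ∈ Set.Icc (c - a) (c + a) → 0 < s * (y σ - b) →
    s * (y σ - b) < ψ (y (1 - σ)) → y ∈ Ω

variable {h₀ : ℝ} {Ω : Set Plane}

theorem sign_mul_mem_Icc {s u a : ℝ} (hs : s = 1 ∨ s = -1) :
    s * u ∈ Set.Icc (-a) a ↔ u ∈ Set.Icc (-a) a := by
  rcases hs with rfl | rfl
  · simp
  · rw [neg_one_mul, Set.neg_mem_Icc_iff, neg_neg]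

/-- The representation with δ = h₀ places x at distance h₀ from the base and the vertical sides; the
one with δ = 0 shows that the full region below the graph belongs to Ω. -/
theorem GraphDomain.exists_chart (G : GraphDomain h₀ Ω) {x : Plane} (hx : x ∈ Ω) :
    ∃ (σ : Fin 2) (s a b c : ℝ) (ψ : ℝ → ℝ), IsChart Ω h₀ x σ s a b c ψ ∧
      (G.GraphsInBoundary → ∀ y : Plane, y (1 - σ) ∈ Set.Icc (c - a) (c + a) →
        s * (y σ - b) = ψ (y (1 - σ)) → y ∉ Ω) := by
  have hx' := hx
  rw [G.eq_iUnion h₀ G.h₀_pos.le le_rfl] at hx'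
  obtain ⟨r, y, ⟨hy1, hy2, hy3, hy4⟩, hyx⟩ := Set.mem_iUnion.1 hx'
  obtain ⟨σ, s, s', hs, hs', h⟩ := axisIsometry_eq_iff (G.rot r) (G.shift r)
  set b := G.shift r σ
  set c := G.shift r (1 - σ)
  obtain ⟨e0, e1⟩ := (h x y).1 hyx
  have hside : ∀ u, s' * (u - c) ∈ Set.Icc (-(G.a r)) (G.a r) ↔
      u ∈ Set.Icc (c - G.a r) (c + G.a r) := by
    intro u
    rw [sign_mul_mem_Icc hs', Set.mem_Icc, Set.mem_Icc]
    constructor <;> rintro ⟨h1, h2⟩ <;> constructor <;> linarith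
  refine ⟨σ, s, G.a r, b, c, fun u => G.φ r (s' * (u - c)), ⟨hs, G.lt_a r, ?_, ?_, ?_, ?_, ?_⟩, ?_⟩
  · refine (G.continuousOn_φ r).comp (by fun_prop) fun u hu => (hside u).2 hu
  · have h1 : s' * (x (1 - σ) - c) ∈ Set.Icc (-(G.a r - h₀)) (G.a r - h₀) := by
      rw [← e0]; exact ⟨by linarith, hy2⟩
    rw [sign_mul_mem_Icc hs'] at h1
    exact ⟨by linarith [h1.1], by linarith [h1.2]⟩
  · rwa [← e1]
  · rwa [← e1, ← e0]
  · intro z hz1 hz2 hz3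
    rw [G.eq_iUnion 0 le_rfl G.h₀_pos.le]
    refine Set.mem_iUnion.2 ⟨r, ![s' * (z (1 - σ) - c), s * (z σ - b)], ?_, ?_⟩
    · have := (hside _).2 hz1
      refine ⟨by simpa using this.1, by simpa using this.2, by simpa using hz2, by simpa using hz3⟩
    · exact (h z _).2 ⟨rfl, rfl⟩
  · intro hG z hz1 hz2
    have h1 := hG r _ ((hside _).2 hz1)
    rwa [(h z _).2 ⟨rfl, hz2.symm⟩] at h1

/-- The model regions contain their vertical sides, but every point of Ω is at distance at least h₀
from the sides of some chart, so continuity of the graph function suffices. -/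
theorem GraphDomain.isOpen (G : GraphDomain h₀ Ω) : IsOpen Ω := by
  rw [isOpen_iff_mem_nhds]
  intro x hx
  obtain ⟨σ, s, a, b, c, ψ, hc, -⟩ := G.exists_chart hx
  have h0 := G.h₀_pos
  have hmem : x (1 - σ) ∈ Set.Ioo (c - a) (c + a) :=
    ⟨by linarith [hc.mem_Icc.1], by linarith [hc.mem_Icc.2]⟩
  have hcx : ContinuousAt (fun y : Plane => y (1 - σ)) x := (continuous_apply _).continuousAt
  have hψ : ContinuousAt (fun y : Plane => ψ (y (1 - σ))) x :=
    ContinuousAt.comp (f := fun y : Plane => y (1 - σ)) (g := ψ)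
      (hc.continuousOn.continuousAt (Icc_mem_nhds hmem.1 hmem.2)) hcx
  have hcs : ContinuousAt (fun y : Plane => s * (y σ - b)) x :=
    (continuous_const.mul ((continuous_apply σ).sub continuous_const)).continuousAt
  filter_upwards [hcx.eventually (isOpen_Ioo.mem_nhds hmem),
    hcs.eventually_const_lt (h0.trans hc.lt_height), hcs.eventually_lt hψ hc.height_lt]
    with y h1 h2 h3
  exact hc.mem y (Set.Ioo_subset_Icc_self h1) h2 h3

theorem GraphDomain.bounded (G : GraphDomain h₀ Ω) : ∃ B : ℝ, ∀ x ∈ Ω, ∀ σ, |x σ| ≤ B := by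
  have hr : ∀ r, ∃ B : ℝ, ∀ x ∈ axisIsometry (G.rot r) (G.shift r) ''
      graphRegion (G.a r) (G.φ r) 0, ∀ σ, |x σ| ≤ B := by
    intro r
    obtain ⟨M, hM⟩ := isCompact_Icc.bddAbove_image (G.continuousOn_φ r)
    obtain ⟨σ, s, s', hs, hs', h⟩ := axisIsometry_eq_iff (G.rot r) (G.shift r)
    refine ⟨|G.shift r σ| + |G.shift r (1 - σ)| + |M| + |G.a r|, ?_⟩
    rintro x ⟨y, ⟨hy1, hy2, hy3, hy4⟩, hyx⟩ τ
    obtain ⟨e0, e1⟩ := (h x y).1 hyx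
    have habs : ∀ {s u : ℝ}, (s = 1 ∨ s = -1) → |s * u| = |u| := by
      rintro s u (rfl | rfl) <;> simp
    have h0 : |x (1 - σ) - G.shift r (1 - σ)| ≤ |G.a r| := by
      rw [← habs hs', ← e0]
      exact (abs_le.2 ⟨by linarith, by linarith⟩).trans (le_abs_self _)
    have h1 : |x σ - G.shift r σ| ≤ |M| := by
      rw [← habs hs, ← e1, abs_of_pos hy3]
      refine hy4.le.trans ((hM ⟨y 0, ⟨by linarith, by linarith⟩, rfl⟩).trans (le_abs_self _))
    have h2 : |x (1 - σ)| ≤ |G.shift r (1 - σ)| + |G.a r| := by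
      have := abs_sub_abs_le_abs_sub (x (1 - σ)) (G.shift r (1 - σ)); linarith
    have h3 : |x σ| ≤ |G.shift r σ| + |M| := by
      have := abs_sub_abs_le_abs_sub (x σ) (G.shift r σ); linarith
    have p1 := abs_nonneg (G.shift r σ)
    have p2 := abs_nonneg (G.shift r (1 - σ))
    have p3 := abs_nonneg M
    have p4 := abs_nonneg (G.a r)
    have : τ = σ ∨ τ = 1 - σ := by fin_cases τ <;> fin_cases σ <;> simp
    rcases this with rfl | rfl <;> linarith
  choose B hB using hr
  refine ⟨∑ r, |B r|, fun x hx σ => ?_⟩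
  rw [G.eq_iUnion 0 le_rfl G.h₀_pos.le] at hx
  obtain ⟨r, hxr⟩ := Set.mem_iUnion.1 hx
  exact (hB r x hxr σ).trans ((le_abs_self _).trans
    (Finset.single_le_sum (f := fun r => |B r|) (fun _ _ => abs_nonneg _) (Finset.mem_univ r)))

theorem GraphDomain.lower_le (G : GraphDomain h₀ Ω) {M : Set Plane} (hM : M ⊆ Ω) {x : Plane}
    (hx : x ∈ M) (σ : Fin 2) : lower M σ ≤ x σ := by
  obtain ⟨B, hB⟩ := G.bounded
  exact csInf_le ⟨-B, by rintro _ ⟨y, hy, rfl⟩; exact (abs_le.1 (hB y (hM hy) σ)).1⟩ ⟨x, hx, rfl⟩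

theorem GraphDomain.le_upper (G : GraphDomain h₀ Ω) {M : Set Plane} (hM : M ⊆ Ω) {x : Plane}
    (hx : x ∈ M) (σ : Fin 2) : x σ ≤ upper M σ := by
  obtain ⟨B, hB⟩ := G.bounded
  exact le_csSup ⟨B, by rintro _ ⟨y, hy, rfl⟩; exact (abs_le.1 (hB y (hM hy) σ)).2⟩ ⟨x, hx, rfl⟩

theorem le_lower {M : Set Plane} (hM : M.Nonempty) {σ : Fin 2} {a : ℝ} (h : ∀ x ∈ M, a ≤ x σ) :
    a ≤ lower M σ :=
  le_csInf (hM.image _) (by rintro _ ⟨x, hx, rfl⟩; exact h x hx)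

theorem upper_le {M : Set Plane} (hM : M.Nonempty) {σ : Fin 2} {a : ℝ} (h : ∀ x ∈ M, x σ ≤ a) :
    upper M σ ≤ a :=
  csSup_le (hM.image _) (by rintro _ ⟨x, hx, rfl⟩; exact h x hx)

end GraphDomain

/-! ## Condensed knots of the indices -/

/-- The assumptions on the knot sequences. -/
structure IsKnots (h₀ : ℝ) (Ω : Set Plane) (n : Fin 2 → ℕ) (T : Fin 2 → ℤ → ℝ) : Prop where
  order_pos : ∀ σ, 1 ≤ n σ
  monotone : ∀ σ, Monotone (T σ)
  lt : ∀ σ k, T σ k < T σ (k + n σ)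
  gap : ∀ σ k, T σ (k + 1) - T σ k ≤ h₀ / ((max (n 0) (n 1) : ℕ) + 1)
  cover : Ω ⊆ ⋃ k, gridCell T k

section Indices

variable {h₀ : ℝ} {Ω : Set Plane} {n : Fin 2 → ℕ} {T : Fin 2 → ℤ → ℝ} {j : Index} {x : Plane}

theorem order_le_max (n : Fin 2 → ℕ) (σ : Fin 2) : n σ ≤ max (n 0) (n 1) := by
  fin_cases σ <;> simp

theorem IsKnots.gap_lt (K : IsKnots h₀ Ω n T) (h0 : 0 < h₀) :
    h₀ / ((max (n 0) (n 1) : ℕ) + 1) < h₀ := by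
  have h1 : (1 : ℝ) ≤ (max (n 0) (n 1) : ℕ) := by
    exact_mod_cast (K.order_pos 0).trans (order_le_max n 0)
  exact div_lt_self h0 (by linarith)

theorem IsKnots.maxGap_le (K : IsKnots h₀ Ω n T) (σ : Fin 2) :
    maxGap (T σ) ≤ h₀ / ((max (n 0) (n 1) : ℕ) + 1) := CdSpline.maxGap_le (K.gap σ)

/-- Every point of the domain belongs to a half-open knot interval, in each direction. -/
theorem IsKnots.exists_knot (K : IsKnots h₀ Ω n T) (hΩ : IsOpen Ω) (hx : x ∈ Ω) (σ : Fin 2) :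
    ∃ k, T σ k ≤ x σ ∧ x σ < T σ (k + 1) := by
  obtain ⟨k₀, hk₀⟩ := Set.mem_iUnion.1 (K.cover hx)
  have h1 : T σ (k₀ σ - 1) ≤ x σ := hk₀.1 σ
  obtain ⟨ε, hε, hball⟩ := Metric.isOpen_iff.1 hΩ x hx
  have hz : Function.update x σ (x σ + ε / 2) ∈ Ω := by
    apply hball
    rw [Metric.mem_ball, dist_pi_lt_iff hε]
    intro ρ
    by_cases h : ρ = σ
    · subst h
      rw [Function.update_self, Real.dist_eq, add_sub_cancel_left, abs_of_pos (by linarith)]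
      linarith
    · rw [Function.update_of_ne h, dist_self]; exact hε
  obtain ⟨k₁, hk₁⟩ := Set.mem_iUnion.1 (K.cover hz)
  have h2 : x σ + ε / 2 ≤ T σ (k₁ σ) := by simpa using hk₁.2 σ
  have h3 : ∀ k, T σ k ≤ x σ → k ≤ k₁ σ := by
    intro k hk
    by_contra hlt
    have := K.monotone σ (not_le.1 hlt).le
    linarith
  obtain ⟨k, hk, hmax⟩ := Int.exists_greatest_of_bdd (P := fun k => T σ k ≤ x σ) ⟨_, h3⟩ ⟨_, h1⟩
  refine ⟨k, hk, ?_⟩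
  by_contra hle
  have := hmax _ (not_lt.1 hle)
  lia

theorem indexSet_subset (hj : j ∈ indexSet Ω n T) : j.2 ⊆ suppBox n T j.1 ∩ Ω :=
  components_subset hj

theorem suppBox_subset_strip (σ : Fin 2) (i : Fin 2 → ℤ) : suppBox n T i ⊆ strip n T σ i :=
  fun _ hx ρ _ => ⟨hx.1 ρ, hx.2 ρ⟩

theorem mem_strip_iff {σ : Fin 2} {i : Fin 2 → ℤ} : x ∈ strip n T σ i ↔
    x (1 - σ) ∈ Set.Icc (T (1 - σ) (i (1 - σ))) (T (1 - σ) (i (1 - σ) + n (1 - σ))) := by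
  constructor
  · intro h; exact h (1 - σ) (by fin_cases σ <;> simp)
  · intro h ρ hρ
    obtain rfl : ρ = 1 - σ := by fin_cases σ <;> fin_cases ρ <;> simp_all
    exact h

theorem stripComponent_eq (hj : j ∈ indexSet Ω n T) (hx : x ∈ j.2) (σ : Fin 2) :
    stripComponent Ω n T j σ = connectedComponentIn (strip n T σ j.1 ∩ Ω) x :=
  componentOf_eq (components_isPreconnected hj)
    (fun _ hy => ⟨suppBox_subset_strip σ _ (indexSet_subset hj hy).1, (indexSet_subset hj hy).2⟩) hx

theorem stripComponent_subset (σ : Fin 2) :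
    stripComponent Ω n T j σ ⊆ strip n T σ j.1 ∩ Ω := componentOf_subset

theorem subset_stripComponent (hj : j ∈ indexSet Ω n T) (σ : Fin 2) :
    j.2 ⊆ stripComponent Ω n T j σ := by
  intro x hx
  rw [stripComponent_eq hj hx]
  exact mem_connectedComponentIn ⟨suppBox_subset_strip σ _ (indexSet_subset hj hx).1,
    (indexSet_subset hj hx).2⟩

/-- The condensed knots in direction `σ` only depend on the point `x` of the support and on the
index in the other direction. -/
theorem condKnots_congr {j j' : Index} (hj : j ∈ indexSet Ω n T) (hj' : j' ∈ indexSet Ω n T)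
    (hx : x ∈ j.2) (hx' : x ∈ j'.2) {σ : Fin 2} (h : j.1 (1 - σ) = j'.1 (1 - σ)) :
    condKnots Ω n T j σ = condKnots Ω n T j' σ := by
  have hs : strip n T σ j.1 = strip n T σ j'.1 := by
    ext y; rw [mem_strip_iff, mem_strip_iff, h]
  have : stripComponent Ω n T j σ = stripComponent Ω n T j' σ := by
    rw [stripComponent_eq hj hx, stripComponent_eq hj' hx', hs]
  simp only [condKnots, omegaLo, omegaHi, this]

/-- The strip is unbounded in direction σ and Ω is open, so the component contains a short segment
through x in this direction. Hence x is not at an end of the bounding box. -/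
theorem mem_omega (G : GraphDomain h₀ Ω) {σ : Fin 2} (hx : x ∈ stripComponent Ω n T j σ) :
    x σ ∈ Set.Ioo (omegaLo Ω n T j σ) (omegaHi Ω n T j σ) := by
  obtain ⟨hxs, hxΩ⟩ := stripComponent_subset σ hx
  obtain ⟨ε, hε, hball⟩ := Metric.isOpen_iff.1 G.isOpen x hxΩ
  have hZ := isPreconnected_box σ (V := Set.Icc (x σ - ε / 2) (x σ + ε / 2))
    (I := {x (1 - σ)}) Set.ordConnected_Icc Set.ordConnected_singleton
  have hsub := subset_componentOf_of_mem (M := strip n T σ j.1) (x := x) (γ := j.2) hZ (by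
    rintro y ⟨⟨hy1, hy2⟩, hy3⟩
    rw [Set.mem_singleton_iff] at hy3
    refine ⟨?_, hball ?_⟩
    · rw [mem_strip_iff, hy3]; exact mem_strip_iff.1 hxs
    · rw [Metric.mem_ball, dist_pi_lt_iff hε]
      intro ρ
      have : ρ = σ ∨ ρ = 1 - σ := by fin_cases ρ <;> fin_cases σ <;> simp
      rcases this with rfl | rfl
      · rw [Real.dist_eq, abs_lt]; constructor <;> linarith
      · rw [hy3, dist_self]; exact hε) ⟨⟨by linarith, by linarith⟩, rfl⟩ hx
  have hW : stripComponent Ω n T j σ ⊆ Ω := fun y hy => (stripComponent_subset σ hy).2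
  have h1 := G.lower_le hW (hsub (a := planeMk σ (x σ - ε / 2) (x (1 - σ)))
    ⟨by rw [planeMk_same]; constructor <;> linarith, by simp⟩) σ
  have h2 := G.le_upper hW (hsub (a := planeMk σ (x σ + ε / 2) (x (1 - σ)))
    ⟨by rw [planeMk_same]; constructor <;> linarith, by simp⟩) σ
  rw [planeMk_same] at h1 h2
  rw [omegaLo, omegaHi]
  constructor <;> linarith

theorem mem_omega_of_mem (G : GraphDomain h₀ Ω) (hj : j ∈ indexSet Ω n T) (hx : x ∈ j.2)
    (σ : Fin 2) : x σ ∈ Set.Ioo (omegaLo Ω n T j σ) (omegaHi Ω n T j σ) :=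
  mem_omega G (subset_stripComponent hj σ hx)

theorem condKnots_monotone (K : IsKnots h₀ Ω n T) (j : Index) (σ : Fin 2) :
    Monotone (condKnots Ω n T j σ) := condense_monotone (K.monotone σ) _ _

theorem condWidth_pos (K : IsKnots h₀ Ω n T) (G : GraphDomain h₀ Ω) (hj : j ∈ indexSet Ω n T)
    (σ : Fin 2) : 0 < condWidth Ω n T j σ := by
  obtain ⟨x, hx⟩ := components_nonempty hj
  obtain ⟨k, h1, h2⟩ := K.exists_knot G.isOpen (indexSet_subset hj hx).2 σ
  exact maxGap_condense_pos (K.monotone σ) (K.gap σ) (mem_omega_of_mem G hj hx σ) h1 h2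

theorem condWidth_le (K : IsKnots h₀ Ω n T) (j : Index) (σ : Fin 2) :
    condWidth Ω n T j σ ≤ h₀ / ((max (n 0) (n 1) : ℕ) + 1) :=
  (maxGap_condense_le (K.monotone σ) (K.gap σ)).trans (K.maxGap_le σ)

theorem condWidth_le_omega (G : GraphDomain h₀ Ω) (hj : j ∈ indexSet Ω n T) (σ : Fin 2) :
    condWidth Ω n T j σ ≤ omegaHi Ω n T j σ - omegaLo Ω n T j σ := by
  obtain ⟨x, hx⟩ := components_nonempty hj
  have h := mem_omega_of_mem G hj hx σ
  exact maxGap_condense_le_sub (h.1.trans h.2).le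

variable {σ : Fin 2} {s a b c : ℝ} {ψ : ℝ → ℝ}

theorem sign_mul_self (hs : s = 1 ∨ s = -1) : s * s = 1 := by rcases hs with rfl | rfl <;> simp

/-- In the direction of a chart, the knots are not condensed. -/
theorem condKnots_eq_of_chart (K : IsKnots h₀ Ω n T) (G : GraphDomain h₀ Ω)
    (hj : j ∈ indexSet Ω n T) (hx : x ∈ j.2) (hc : IsChart Ω h₀ x σ s a b c ψ) :
    condKnots Ω n T j σ = T σ := by
  have h0 := G.h₀_pos
  apply condense_eq_of_lt
  refine ((K.maxGap_le σ).trans_lt (K.gap_lt h0)).trans ?_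
  have hs := sign_mul_self hc.sign
  -- Half of the excess of the height of x over h₀: the segment from height δ up to x stays strictly
  -- above the base and is still longer than h₀.
  set δ := (s * (x σ - b) - h₀) / 2 with hδ
  have hδ0 : 0 < δ := by have := hc.lt_height; rw [hδ]; linarith
  have hside : x (1 - σ) ∈ Set.Icc (c - a) (c + a) :=
    ⟨by linarith [hc.mem_Icc.1], by linarith [hc.mem_Icc.2]⟩
  have hV : ({v | s * (v - b) ∈ Set.Icc δ (s * (x σ - b))} : Set ℝ).OrdConnected := by
    rcases hc.sign with rfl | rfl
    · refine ⟨fun u hu v hv w hw => ?_⟩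
      exact ⟨by linarith [hu.1, hw.1], by linarith [hv.2, hw.2]⟩
    · refine ⟨fun u hu v hv w hw => ?_⟩
      exact ⟨by linarith [hv.1, hw.2], by linarith [hu.2, hw.1]⟩
  have hZ := isPreconnected_box σ hV (I := {x (1 - σ)}) Set.ordConnected_singleton
  have hxs := (indexSet_subset hj hx).1
  have hle : δ ≤ s * (x σ - b) := by rw [hδ]; linarith [hc.lt_height]
  have hsub := subset_componentOf (M := strip n T σ j.1) (x := x) (γ := j.2) hZ (by
    rintro y ⟨⟨hy1, hy2⟩, hy3⟩
    rw [Set.mem_singleton_iff] at hy3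
    refine ⟨?_, hc.mem y (hy3 ▸ hside) (by linarith) ?_⟩
    · rw [mem_strip_iff, hy3]; exact ⟨hxs.1 _, hxs.2 _⟩
    · rw [hy3]; linarith [hc.height_lt]) ⟨⟨hle, le_rfl⟩, rfl⟩ hx
  have h1 := mem_omega G (hsub (a := planeMk σ (b + s * δ) (x (1 - σ)))
    ⟨by
      simp only [planeMk_same, Set.mem_ofPred_eq, add_sub_cancel_left, ← mul_assoc, hs, one_mul]
      exact ⟨le_rfl, hle⟩, by simp⟩)
  have h2 := mem_omega_of_mem G hj hx σ
  rw [planeMk_same] at h1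
  have h3 : h₀ < s * (x σ - b) - δ := by rw [hδ]; linarith [hc.lt_height]
  rcases hc.sign with rfl | rfl
  · linarith [h1.1, h2.2]
  · linarith [h1.2, h2.1]

/-! ## Existence of local boxes -/

/-- If h is the full length, only the open interval will do; this is why boxes may lack end points.
Otherwise h is split around u in proportion to the distances of u from the ends. -/
theorem exists_interval_of_mem_Ioo {lo hi h u : ℝ} (h0 : 0 ≤ h) (hle : h ≤ hi - lo)
    (hu : u ∈ Set.Ioo lo hi) : ∃ (l : ℝ) (I : Set ℝ), I.OrdConnected ∧ Set.Ioo l (l + h) ⊆ I ∧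
      I ⊆ Set.Icc l (l + h) ∧ I ⊆ Set.Ioo lo hi ∧ u ∈ I := by
  rcases hle.eq_or_lt with heq | hlt
  · refine ⟨lo, Set.Ioo lo hi, Set.ordConnected_Ioo, ?_, ?_, le_rfl, hu⟩
    · rw [heq, add_sub_cancel]
    · rw [heq, add_sub_cancel]; exact Set.Ioo_subset_Icc_self
  · have hw : 0 < hi - lo := by linarith [hu.1, hu.2]
    have h1 : (u - lo) / (hi - lo) * h < u - lo := by
      rw [div_mul_eq_mul_div, div_lt_iff₀ hw]
      exact mul_lt_mul_of_pos_left hlt (sub_pos.2 hu.1)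
    have h2 : (hi - u) / (hi - lo) * h < hi - u := by
      rw [div_mul_eq_mul_div, div_lt_iff₀ hw]
      exact mul_lt_mul_of_pos_left hlt (sub_pos.2 hu.2)
    have h3 : (u - lo) / (hi - lo) * h + (hi - u) / (hi - lo) * h = h := by field_simp; ring
    have h4 : 0 ≤ (u - lo) / (hi - lo) * h :=
      mul_nonneg (div_nonneg (by linarith [hu.1]) hw.le) h0
    have h5 : 0 ≤ (hi - u) / (hi - lo) * h :=
      mul_nonneg (div_nonneg (by linarith [hu.2]) hw.le) h0
    refine ⟨u - (u - lo) / (hi - lo) * h, Set.Icc _ _, Set.ordConnected_Icc,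
      Set.Ioo_subset_Icc_self, le_rfl, fun v hv => ⟨?_, ?_⟩, ⟨?_, ?_⟩⟩
    · linarith [hv.1]
    · linarith [hv.2]
    · linarith
    · linarith

theorem exists_last_le {f : ℝ → ℝ} {p q E : ℝ} (hf : ContinuousOn f (Set.Icc p q))
    (hne : ∃ u ∈ Set.Icc p q, f u ≤ E) :
    ∃ α ∈ Set.Icc p q, f α ≤ E ∧ ∀ u, α < u → u ≤ q → E < f u := by
  have hcl : IsClosed (Set.Icc p q ∩ f ⁻¹' Set.Iic E) :=
    hf.preimage_isClosed_of_isClosed isClosed_Icc isClosed_Iic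
  have hcpt : IsCompact (Set.Icc p q ∩ f ⁻¹' Set.Iic E) :=
    isCompact_Icc.of_isClosed_subset hcl Set.inter_subset_left
  obtain ⟨u, hu, hu'⟩ := hne
  obtain ⟨α, hα, hmax⟩ := hcpt.exists_isGreatest ⟨u, hu, hu'⟩
  refine ⟨α, hα.1, hα.2, fun v hv hvq => ?_⟩
  by_contra hle
  exact (hmax ⟨⟨hα.1.1.trans hv.le, hvq⟩, not_lt.1 hle⟩).not_gt hv

theorem exists_first_le {f : ℝ → ℝ} {p q E : ℝ} (hf : ContinuousOn f (Set.Icc p q))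
    (hne : ∃ u ∈ Set.Icc p q, f u ≤ E) :
    ∃ α ∈ Set.Icc p q, f α ≤ E ∧ ∀ u, u < α → p ≤ u → E < f u := by
  have hcl : IsClosed (Set.Icc p q ∩ f ⁻¹' Set.Iic E) :=
    hf.preimage_isClosed_of_isClosed isClosed_Icc isClosed_Iic
  have hcpt : IsCompact (Set.Icc p q ∩ f ⁻¹' Set.Iic E) :=
    isCompact_Icc.of_isClosed_subset hcl Set.inter_subset_left
  obtain ⟨u, hu, hu'⟩ := hne
  obtain ⟨α, hα, hmin⟩ := hcpt.exists_isLeast ⟨u, hu, hu'⟩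
  refine ⟨α, hα.1, hα.2, fun v hv hvp => ?_⟩
  by_contra hle
  exact (hmin ⟨⟨hvp, hv.le.trans hα.1.2⟩, not_lt.1 hle⟩).not_gt hv

/-- If the graph bounds the strip from above at height `E` over both end points of `[α, β]`, then
the component of the strip stays between `α` and `β`. -/
theorem stripComponent_subset_of_graph (hj : j ∈ indexSet Ω n T) (hx : x ∈ j.2)
    (hc : IsChart Ω h₀ x σ s a b c ψ)
    (hgraph : ∀ y : Plane, y (1 - σ) ∈ Set.Icc (c - a) (c + a) →
      s * (y σ - b) = ψ (y (1 - σ)) → y ∉ Ω)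
    {E α β : ℝ} (hE : ∀ y ∈ stripComponent Ω n T j (1 - σ), E ≤ s * (y σ - b))
    (hα : c - a ≤ α) (hβ : β ≤ c + a) (hxα : α < x (1 - σ)) (hxβ : x (1 - σ) < β)
    (hψα : ψ α ≤ E) (hψβ : ψ β ≤ E) :
    ∀ y ∈ stripComponent Ω n T j (1 - σ), y (1 - σ) ∈ Set.Ioo α β := by
  have hcont : ContinuousOn ψ (Set.Icc α β) :=
    hc.continuousOn.mono (Set.Icc_subset_Icc hα hβ)
  have hcρ : Continuous fun y : Plane => y (1 - σ) := continuous_apply _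
  have hcσ : Continuous fun y : Plane => s * (y σ - b) :=
    continuous_const.mul ((continuous_apply σ).sub continuous_const)
  set F : Set Plane := (fun y : Plane => y (1 - σ)) ⁻¹' Set.Icc α β with hF
  have hcF : ContinuousOn (fun y : Plane => ψ (y (1 - σ)) - s * (y σ - b)) F :=
    (hcont.comp hcρ.continuousOn fun y hy => hy).sub hcσ.continuousOn
  -- The open set `U₁` and the closed set `D` differ only by points on the graph or above α and β,
  -- none of which belong to the strip component. On that component the region below the graph is
  -- therefore both open and closed.
  set U₁ : Set Plane := {y | y (1 - σ) ∈ Set.Ioo α β ∧ 0 < ψ (y (1 - σ)) - s * (y σ - b)} with hU₁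
  have ho₁ : IsOpen U₁ := (hcF.mono fun y hy => Set.Ioo_subset_Icc_self hy).isOpen_inter_preimage
    (isOpen_Ioo.preimage hcρ) isOpen_Ioi
  set D : Set Plane := F ∩ {y | 0 ≤ ψ (y (1 - σ)) - s * (y σ - b)} with hD
  have hcD : IsClosed D := hcF.preimage_isClosed_of_isClosed (isClosed_Icc.preimage hcρ) isClosed_Ici
  have hW : IsPreconnected (stripComponent Ω n T j (1 - σ)) := by
    rw [stripComponent_eq hj hx]; exact isPreconnected_connectedComponentIn
  have hcover : stripComponent Ω n T j (1 - σ) ⊆ U₁ ∪ Dᶜ := by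
    intro y hy
    by_cases hyD : y ∈ D
    · left
      obtain ⟨⟨hy1, hy2⟩, hy3⟩ := hyD
      have hyE := hE y hy
      have hyΩ := (stripComponent_subset (1 - σ) hy).2
      have hne : ψ (y (1 - σ)) - s * (y σ - b) ≠ 0 := by
        intro h
        exact hgraph y ⟨hα.trans hy1, hy2.trans hβ⟩ (by linarith) hyΩ
      have hpos : 0 < ψ (y (1 - σ)) - s * (y σ - b) := lt_of_le_of_ne hy3 (Ne.symm hne)
      refine ⟨⟨lt_of_le_of_ne hy1 fun h => ?_, lt_of_le_of_ne hy2 fun h => ?_⟩, hpos⟩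
      -- Above α, or in the next case β, the graph is at most at height E, while the whole strip
      -- component is at height at least E.
      · rw [← h] at hpos; linarith
      · rw [h] at hpos; linarith
    · exact Or.inr hyD
  have hdisj : Disjoint U₁ Dᶜ := by
    rw [Set.disjoint_compl_right_iff_subset]
    intro y hy
    exact ⟨Set.Ioo_subset_Icc_self hy.1, hy.2.le⟩
  have hsub := hW.subset_left_of_subset_union ho₁ hcD.isOpen_compl hdisj hcover
    ⟨x, subset_stripComponent hj _ hx, ⟨hxα, hxβ⟩, sub_pos.2 hc.height_lt⟩
  exact fun y hy => (hsub hy).1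

end Indices

section Existence

variable {h₀ : ℝ} {Ω : Set Plane} {n : Fin 2 → ℕ} {T : Fin 2 → ℤ → ℝ} {j : Index} {x : Plane}
variable {σ : Fin 2} {s a b c : ℝ} {ψ : ℝ → ℝ}

theorem eq_or_eq_one_sub (σ ρ : Fin 2) : ρ = σ ∨ ρ = 1 - σ := by
  fin_cases ρ <;> fin_cases σ <;> simp

/-- Going down from `x` in the direction of a chart, one meets the edge of `S_i` inside the
support. -/
theorem edge_point_mem (hj : j ∈ indexSet Ω n T) (hx : x ∈ j.2) (hc : IsChart Ω h₀ x σ s a b c ψ)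
    (h0 : 0 ≤ h₀) {e : ℝ} (he : e ∈ Set.Icc (T σ (j.1 σ)) (T σ (j.1 σ + n σ)))
    (hE : ∀ v ∈ Set.Icc (T σ (j.1 σ)) (T σ (j.1 σ + n σ)), s * (e - b) ≤ s * (v - b))
    (hE0 : 0 < s * (e - b)) : planeMk σ e (x (1 - σ)) ∈ j.2 := by
  have hxs := (indexSet_subset hj hx).1
  have hxσ : x σ ∈ Set.Icc (T σ (j.1 σ)) (T σ (j.1 σ + n σ)) := ⟨hxs.1 σ, hxs.2 σ⟩
  have hV : ∀ v ∈ Set.uIcc e (x σ), s * (v - b) ≤ s * (x σ - b) := by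
    intro v hv
    have := hE _ hxσ
    rcases hc.sign with rfl | rfl
    · rw [Set.uIcc_of_le (by linarith)] at hv
      linarith [hv.2]
    · rw [Set.uIcc_of_ge (by linarith)] at hv
      linarith [hv.1]
  have hsub : Set.uIcc e (x σ) ⊆ Set.Icc (T σ (j.1 σ)) (T σ (j.1 σ + n σ)) :=
    Set.ordConnected_Icc.uIcc_subset he hxσ
  refine subset_of_mem_components (x := x) hj (isPreconnected_box σ (Set.ordConnected_uIcc
    (a := e) (b := x σ)) (I := {x (1 - σ)}) Set.ordConnected_singleton) ?_
    ⟨Set.right_mem_uIcc, rfl⟩ hx ⟨by simp, by simp⟩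
  rintro y ⟨hy1, hy2⟩
  rw [Set.mem_singleton_iff] at hy2
  refine ⟨⟨fun ρ => ?_, fun ρ => ?_⟩, hc.mem y ?_ (hE0.trans_le (hE _ (hsub hy1))) ?_⟩
  · rcases eq_or_eq_one_sub σ ρ with rfl | rfl
    · exact (hsub hy1).1
    · rw [hy2]; exact hxs.1 _
  · rcases eq_or_eq_one_sub σ ρ with rfl | rfl
    · exact (hsub hy1).2
    · rw [hy2]; exact hxs.2 _
  · rw [hy2]; exact ⟨by linarith [hc.mem_Icc.1], by linarith [hc.mem_Icc.2]⟩
  · rw [hy2]; exact (hV _ hy1).trans_lt hc.height_lt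

/-- Below the graph, at height `E`, there is room for the side of a local box. -/
theorem exists_interval_below_graph (K : IsKnots h₀ Ω n T) (G : GraphDomain h₀ Ω)
    (hj : j ∈ indexSet Ω n T) (hx : x ∈ j.2) (hc : IsChart Ω h₀ x σ s a b c ψ)
    (hgraph : ∀ y : Plane, y (1 - σ) ∈ Set.Icc (c - a) (c + a) →
      s * (y σ - b) = ψ (y (1 - σ)) → y ∉ Ω)
    {e : ℝ} (he : e ∈ Set.Icc (T σ (j.1 σ)) (T σ (j.1 σ + n σ)))
    (hE : ∀ v ∈ Set.Icc (T σ (j.1 σ)) (T σ (j.1 σ + n σ)), s * (e - b) ≤ s * (v - b))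
    (hE0 : 0 < s * (e - b)) :
    ∃ (l : ℝ) (I : Set ℝ), I.OrdConnected ∧
      Set.Ioo l (l + condWidth Ω n T j (1 - σ)) ⊆ I ∧
      I ⊆ Set.Icc l (l + condWidth Ω n T j (1 - σ)) ∧
      I ⊆ Set.Ioo (omegaLo Ω n T j (1 - σ)) (omegaHi Ω n T j (1 - σ)) ∧ x (1 - σ) ∈ I ∧
      ∀ u ∈ I, u ∈ Set.Icc (c - a) (c + a) ∧ s * (e - b) < ψ u := by
  have h0 := G.h₀_pos
  set h := condWidth Ω n T j (1 - σ) with hh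
  have hpos : 0 < h := condWidth_pos K G hj _
  have hlt : h < h₀ := (condWidth_le K j _).trans_lt (K.gap_lt h0)
  obtain ⟨hc1, hc2⟩ := hc.mem_Icc
  have hxs := (indexSet_subset hj hx).1
  have hEx : s * (e - b) ≤ s * (x σ - b) := hE _ ⟨hxs.1 σ, hxs.2 σ⟩
  have hψx := hEx.trans_lt hc.height_lt
  have h11 : (1 : Fin 2) - (1 - σ) = σ := by fin_cases σ <;> rfl
  have hstrip : ∀ {y : Plane}, y ∈ strip n T (1 - σ) j.1 ↔
      y σ ∈ Set.Icc (T σ (j.1 σ)) (T σ (j.1 σ + n σ)) := by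
    intro y; rw [mem_strip_iff, h11]
  have hz := edge_point_mem hj hx hc h0.le he hE hE0
  -- The segment over `I` at the level of the edge lies in Ω and in the transverse strip and meets γ
  -- at the edge point. It is therefore part of the strip component, and `I` is contained in ω.
  have hseg : ∀ {I : Set ℝ}, I.OrdConnected → x (1 - σ) ∈ I → I ⊆ Set.Icc (c - a) (c + a) →
      (∀ u ∈ I, s * (e - b) < ψ u) →
      I ⊆ Set.Ioo (omegaLo Ω n T j (1 - σ)) (omegaHi Ω n T j (1 - σ)) := by
    intro I hI hxI hI1 hI2 u hu
    have hsub := subset_componentOf (M := strip n T (1 - σ) j.1)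
      (x := planeMk σ e (x (1 - σ))) (γ := j.2) (isPreconnected_box σ (V := {e})
      Set.ordConnected_singleton hI) (by
        rintro y ⟨hy1, hy2⟩
        rw [Set.mem_singleton_iff] at hy1
        refine ⟨hstrip.2 (hy1 ▸ he), hc.mem y (hI1 hy2) (by rwa [hy1]) ?_⟩
        rw [hy1]; exact hI2 _ hy2) ⟨by simp, by simpa using hxI⟩ hz
    have := mem_omega G (hsub (a := planeMk σ e u) ⟨by simp, by simpa using hu⟩)
    simpa using this
  -- If the graph falls to the level of the edge on both sides of x, the nearest such points α and β
  -- confine ω. If it stays above on one side, an interval of length h < h₀ with end point x fits on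
  -- that side of the chart.
  by_cases hleft : ∃ u ∈ Set.Icc (c - a) (x (1 - σ)), ψ u ≤ s * (e - b)
  · by_cases hright : ∃ u ∈ Set.Icc (x (1 - σ)) (c + a), ψ u ≤ s * (e - b)
    · obtain ⟨α, hα, hψα, hα'⟩ := exists_last_le
        (hc.continuousOn.mono (Set.Icc_subset_Icc le_rfl (by linarith))) hleft
      obtain ⟨β, hβ, hψβ, hβ'⟩ := exists_first_le
        (hc.continuousOn.mono (Set.Icc_subset_Icc (by linarith) le_rfl)) hright
      have hxα : α < x (1 - σ) := lt_of_le_of_ne hα.2 fun h => by rw [← h] at hψx; linarith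
      have hxβ : x (1 - σ) < β := lt_of_le_of_ne hβ.1 fun h => by rw [h] at hψx; linarith
      have hW := stripComponent_subset_of_graph hj hx hc hgraph
        (fun y hy => hE _ (hstrip.1 (stripComponent_subset _ hy).1)) hα.1 hβ.2 hxα hxβ hψα hψβ
      have hne : (stripComponent Ω n T j (1 - σ)).Nonempty := ⟨x, subset_stripComponent hj _ hx⟩
      have hlo : α ≤ omegaLo Ω n T j (1 - σ) := le_lower hne fun y hy => (hW y hy).1.le
      have hhi : omegaHi Ω n T j (1 - σ) ≤ β := upper_le hne fun y hy => (hW y hy).2.le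
      obtain ⟨l, I, hI, hI1, hI2, hI3, hxI⟩ := exists_interval_of_mem_Ioo hpos.le
        (condWidth_le_omega G hj _) (mem_omega_of_mem G hj hx (1 - σ))
      refine ⟨l, I, hI, hI1, hI2, hI3, hxI, fun u hu => ?_⟩
      have h1 : α < u := hlo.trans_lt (hI3 hu).1
      have h2 : u < β := (hI3 hu).2.trans_le hhi
      refine ⟨⟨hα.1.trans h1.le, h2.le.trans hβ.2⟩, ?_⟩
      rcases le_total u (x (1 - σ)) with h | h
      · exact hα' u h1 h
      · exact hβ' u h2 h
    · push Not at hright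
      have hI1 : Set.Icc (x (1 - σ)) (x (1 - σ) + h) ⊆ Set.Icc (c - a) (c + a) :=
        Set.Icc_subset_Icc (by linarith) (by linarith)
      have hI2 : ∀ u ∈ Set.Icc (x (1 - σ)) (x (1 - σ) + h), s * (e - b) < ψ u :=
        fun u hu => hright u ⟨hu.1, (hI1 hu).2⟩
      have hxI : x (1 - σ) ∈ Set.Icc (x (1 - σ)) (x (1 - σ) + h) := ⟨le_rfl, by linarith⟩
      exact ⟨x (1 - σ), _, Set.ordConnected_Icc, Set.Ioo_subset_Icc_self, le_rfl,
        hseg Set.ordConnected_Icc hxI hI1 hI2, hxI, fun u hu => ⟨hI1 hu, hI2 u hu⟩⟩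
  · push Not at hleft
    have hI1 : Set.Icc (x (1 - σ) - h) (x (1 - σ) - h + h) ⊆ Set.Icc (c - a) (c + a) :=
      Set.Icc_subset_Icc (by linarith) (by linarith)
    have hI2 : ∀ u ∈ Set.Icc (x (1 - σ) - h) (x (1 - σ) - h + h), s * (e - b) < ψ u :=
      fun u hu => hleft u ⟨(hI1 hu).1, by linarith [hu.2]⟩
    have hxI : x (1 - σ) ∈ Set.Icc (x (1 - σ) - h) (x (1 - σ) - h + h) :=
      ⟨by linarith, by linarith⟩
    exact ⟨x (1 - σ) - h, _, Set.ordConnected_Icc, Set.Ioo_subset_Icc_self, le_rfl,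
      hseg Set.ordConnected_Icc hxI hI1 hI2, hxI, fun u hu => ⟨hI1 hu, hI2 u hu⟩⟩

/-- If the graphs lie in the boundary, then every index has an admissible local box. -/
theorem exists_isLocalBox (K : IsKnots h₀ Ω n T) (G : GraphDomain h₀ Ω) (hG : G.GraphsInBoundary)
    (hj : j ∈ indexSet Ω n T) : ∃ H, IsLocalBox Ω n T j H := by
  obtain ⟨x, hx⟩ := components_nonempty hj
  obtain ⟨σ, s, a, b, c, ψ, hc, hgraph⟩ := G.exists_chart (indexSet_subset hj hx).2
  have h0 := G.h₀_pos
  have hxs := (indexSet_subset hj hx).1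
  have hxσ : x σ ∈ Set.Icc (T σ (j.1 σ)) (T σ (j.1 σ + n σ)) := ⟨hxs.1 σ, hxs.2 σ⟩
  have hT : T σ (j.1 σ) ≤ T σ (j.1 σ + n σ) := (K.lt σ _).le
  set h := condWidth Ω n T j σ with hh
  have hpos : 0 < h := condWidth_pos K G hj σ
  set N : ℝ := ((max (n 0) (n 1) : ℕ) : ℝ)
  set g := h₀ / (N + 1) with hgdef
  have hg : h ≤ g := condWidth_le K j σ
  have hN : (n σ : ℝ) ≤ N := Nat.cast_le.2 (order_le_max n σ)
  have hN0 : (0 : ℝ) ≤ N := Nat.cast_nonneg _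
  have hg0 : 0 < g := by positivity
  -- The height h₀ is budgeted as n̄ knot intervals for the support plus one for the box.
  have hNg : N * g + g = h₀ := by rw [hgdef]; field_simp
  have hlen : T σ (j.1 σ + n σ) - T σ (j.1 σ) ≤ N * g :=
    (sub_le_mul_of_gap_le (K.gap σ) _ _).trans (mul_le_mul_of_nonneg_right hN hg0.le)
  obtain ⟨e, V, hVdef, heV, hVord, he, hE, hVE⟩ : ∃ (e : ℝ) (V : Set ℝ),
      ((e = T σ (j.1 σ) ∧ V = Set.Icc (e - h) e) ∨
        (e = T σ (j.1 σ + n σ) ∧ V = Set.Icc e (e + h))) ∧ e ∈ V ∧ V.OrdConnected ∧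
      e ∈ Set.Icc (T σ (j.1 σ)) (T σ (j.1 σ + n σ)) ∧
      (∀ v ∈ Set.Icc (T σ (j.1 σ)) (T σ (j.1 σ + n σ)), s * (e - b) ≤ s * (v - b)) ∧
      ∀ v ∈ V, s * (e - b) - h ≤ s * (v - b) ∧ s * (v - b) ≤ s * (e - b) ∧
        e - h ≤ v ∧ v ≤ e + h := by
    -- The edge facing the base is the lower one for s = 1 and the upper one for s = -1.
    rcases hc.sign with rfl | rfl
    · refine ⟨T σ (j.1 σ), _, Or.inl ⟨rfl, rfl⟩, ⟨by linarith, le_rfl⟩, Set.ordConnected_Icc,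
        ⟨le_rfl, hT⟩, fun v hv => by linarith [hv.1], fun v hv => ?_⟩
      obtain ⟨hv1, hv2⟩ := hv
      refine ⟨?_, ?_, ?_, ?_⟩ <;> linarith
    · refine ⟨T σ (j.1 σ + n σ), _, Or.inr ⟨rfl, rfl⟩, ⟨le_rfl, by linarith⟩,
        Set.ordConnected_Icc, ⟨hT, le_rfl⟩, fun v hv => by linarith [hv.2], fun v hv => ?_⟩
      obtain ⟨hv1, hv2⟩ := hv
      refine ⟨?_, ?_, ?_, ?_⟩ <;> linarith
  have hEh : 0 < s * (e - b) - h := by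
    have h1 : s * (x σ - b) - s * (e - b) ≤ N * g := by
      refine le_trans ?_ hlen
      rcases hc.sign with rfl | rfl
      · linarith [hxσ.2, he.1]
      · linarith [hxσ.1, he.2]
    linarith [hc.lt_height]
  obtain ⟨l, I, hI, hI1, hI2, hI3, hxI, hIE⟩ := exists_interval_below_graph K G hj hx hc
    (hgraph hG) he hE (by linarith)
  have hz := edge_point_mem hj hx hc h0.le he hE (by linarith)
  have hγΩ : j.2 ⊆ Ω := fun y hy => (indexSet_subset hj hy).2
  refine ⟨{y | y σ ∈ V ∧ y (1 - σ) ∈ I}, σ, e, V, l, I, planeMk σ e (x (1 - σ)), hVdef, hI1, hI2,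
    hI3, hz, by simp, by simpa using hxI, rfl, ?_⟩
  refine subset_componentOf (x := planeMk σ e (x (1 - σ))) (isPreconnected_box σ hVord hI) ?_
    ⟨by simpa using heV, by simpa using hxI⟩ hz
  rintro y ⟨hy1, hy2⟩
  obtain ⟨hv1, hv2, hv3, hv4⟩ := hVE _ hy1
  have hlo := G.lower_le hγΩ hz
  have hhi := G.le_upper hγΩ hz
  refine ⟨⟨fun ρ => ?_, fun ρ => ?_⟩, hc.mem y (hIE _ hy2).1 (by linarith)
    (hv2.trans_lt (hIE _ hy2).2)⟩
  · rw [Pi.sub_apply]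
    rcases eq_or_eq_one_sub σ ρ with rfl | rfl
    · have := hlo ρ
      rw [planeMk_same] at this
      linarith
    · have := hlo (1 - σ)
      rw [planeMk_other] at this
      linarith [(hI2 hy2).1, (hI2 hxI).2]
  · rw [Pi.add_apply]
    rcases eq_or_eq_one_sub σ ρ with rfl | rfl
    · have := hhi ρ
      rw [planeMk_same] at this
      linarith
    · have := hhi (1 - σ)
      rw [planeMk_other] at this
      linarith [(hI2 hy2).2, (hI2 hxI).1]

end Existence

/-! ## The quasi-interpolant at a point -/

section PointValues

variable {h₀ : ℝ} {Ω : Set Plane} {n : Fin 2 → ℕ} {T : Fin 2 → ℤ → ℝ} {j : Index} {x : Plane}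

/-- The index `j = (i, γ)` with `i = k - (s₁, s₂)` and `x ∈ γ`. -/
def indexAt (Ω : Set Plane) (n : Fin 2 → ℕ) (T : Fin 2 → ℤ → ℝ) (k : Fin 2 → ℤ) (x : Plane)
    (s : ℕ × ℕ) : Index :=
  (![k 0 - s.1, k 1 - s.2],
    connectedComponentIn (suppBox n T ![k 0 - s.1, k 1 - s.2] ∩ Ω) x)

theorem indexAt_injective (k : Fin 2 → ℤ) (x : Plane) :
    Function.Injective (indexAt Ω n T k x) := by
  intro s s' h
  have h1 := congrArg Prod.fst h
  have h2 := congrFun h1 0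
  have h3 := congrFun h1 1
  simp only [indexAt, Matrix.cons_val_zero, Matrix.cons_val_one] at h2 h3
  exact Prod.ext (by lia) (by lia)

theorem mem_suppBox_sub (K : IsKnots h₀ Ω n T) {k : Fin 2 → ℤ}
    (hk : ∀ σ, T σ (k σ) ≤ x σ ∧ x σ ≤ T σ (k σ + 1)) {s : ℕ × ℕ} (h1 : s.1 < n 0)
    (h2 : s.2 < n 1) : x ∈ suppBox n T ![k 0 - s.1, k 1 - s.2] := by
  constructor <;> refine fun σ => ?_ <;> fin_cases σ <;> simp
  · exact (K.monotone 0 (by lia)).trans (hk 0).1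
  · exact (K.monotone 1 (by lia)).trans (hk 1).1
  · exact (hk 0).2.trans (K.monotone 0 (by lia))
  · exact (hk 1).2.trans (K.monotone 1 (by lia))

theorem indexAt_mem (K : IsKnots h₀ Ω n T) (hx : x ∈ Ω) {k : Fin 2 → ℤ}
    (hk : ∀ σ, T σ (k σ) ≤ x σ ∧ x σ ≤ T σ (k σ + 1)) {s : ℕ × ℕ} (h1 : s.1 < n 0)
    (h2 : s.2 < n 1) : indexAt Ω n T k x s ∈ indexSet Ω n T ∧ x ∈ (indexAt Ω n T k x s).2 := by
  have hm : x ∈ suppBox n T ![k 0 - s.1, k 1 - s.2] ∩ Ω := ⟨mem_suppBox_sub K hk h1 h2, hx⟩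
  exact ⟨⟨x, hm, rfl⟩, mem_connectedComponentIn hm⟩

/-- An index is determined by its grid part together with one point of its support. -/
theorem exists_eq_indexAt (hj : j ∈ indexSet Ω n T) (hx : x ∈ j.2) {k : Fin 2 → ℤ}
    (h : ∀ σ, j.1 σ ≤ k σ ∧ k σ < j.1 σ + n σ) :
    ∃ s ∈ Finset.range (n 0) ×ˢ Finset.range (n 1), indexAt Ω n T k x s = j := by
  refine ⟨((k 0 - j.1 0).toNat, (k 1 - j.1 1).toNat), ?_, ?_⟩
  · have := h 0
    have := h 1
    simp only [Finset.mem_product, Finset.mem_range]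
    constructor <;> lia
  · have e : ![k 0 - ((k 0 - j.1 0).toNat : ℤ), k 1 - ((k 1 - j.1 1).toNat : ℤ)] = j.1 := by
      funext σ
      have := h 0
      have := h 1
      fin_cases σ <;> simp <;> lia
    refine Prod.ext e ?_
    simp only [indexAt, e]
    exact (components_eq hj hx).symm

/-- At a point, only the `n₁ n₂` indices whose supports contain the knot interval matter. -/
theorem finsum_cdB_mul (K : IsKnots h₀ Ω n T) (G : GraphDomain h₀ Ω) (hx : x ∈ Ω)
    {k : Fin 2 → ℤ} (hk : ∀ σ, T σ (k σ) ≤ x σ ∧ x σ < T σ (k σ + 1)) (g : Index → ℝ) :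
    ∑ᶠ j ∈ indexSet Ω n T, cdB Ω n T j x * g j =
      ∑ s ∈ Finset.range (n 0) ×ˢ Finset.range (n 1),
        cdB Ω n T (indexAt Ω n T k x s) x * g (indexAt Ω n T k x s) := by
  classical
  rw [← Finset.sum_image (f := fun j => cdB Ω n T j x * g j)
    ((indexAt_injective (Ω := Ω) (n := n) (T := T) k x).injOn)]
  apply finsum_mem_eq_sum_of_inter_support_eq
  ext j
  simp only [Set.mem_inter_iff, Function.mem_support, Finset.coe_image, Set.mem_image,
    Finset.mem_coe]
  constructor
  · rintro ⟨hj, hne⟩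
    refine ⟨?_, hne⟩
    have hb : cdB Ω n T j x ≠ 0 := left_ne_zero_of_mul hne
    have hxj : x ∈ j.2 := Set.mem_of_indicator_ne_zero hb
    rw [cdB, Set.indicator_of_mem hxj, Finset.prod_ne_zero_iff] at hb
    refine exists_eq_indexAt hj hxj fun σ => ?_
    have hω := mem_omega_of_mem G hj hxj σ
    -- The support is known for the condensed knots. As x lies in ω, both inequalities carry over to
    -- the original knots and bound the index.
    obtain ⟨h1, h2⟩ := bspline_support (condKnots_monotone K j σ) (hb σ (Finset.mem_univ σ))
    have h3 := (condense_le_iff hω _).1 h1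
    have h4 := not_le.1 (mt (condense_le_iff hω _).2 h2.not_ge)
    constructor
    · by_contra h
      have := K.monotone σ (show k σ + 1 ≤ j.1 σ by lia)
      linarith [(hk σ).2]
    · by_contra h
      have := K.monotone σ (show j.1 σ + n σ ≤ k σ by lia)
      linarith [(hk σ).1]
  · rintro ⟨⟨s, hs, rfl⟩, hne⟩
    obtain ⟨h1, h2⟩ := Finset.mem_product.1 hs
    exact ⟨(indexAt_mem K hx (fun σ => ⟨(hk σ).1, (hk σ).2.le⟩) (Finset.mem_range.1 h1)
      (Finset.mem_range.1 h2)).1, hne⟩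

theorem abs_cdB_le (K : IsKnots h₀ Ω n T) (j : Index) (x : Plane) :
    |cdB Ω n T j x| ≤ 2 ^ (n 0 + n 1) := by
  by_cases hx : x ∈ j.2
  · rw [cdB, Set.indicator_of_mem hx, Fin.prod_univ_two, abs_mul, pow_add]
    exact mul_le_mul (abs_bspline_le (condKnots_monotone K j 0) _ _ _)
      (abs_bspline_le (condKnots_monotone K j 1) _ _ _) (abs_nonneg _) (by positivity)
  · rw [cdB, Set.indicator_of_notMem hx, abs_zero]; positivity

end PointValues

/-! ## Reproduction of polynomials -/

section Reproduction

open Polynomial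

variable {h₀ : ℝ} {Ω : Set Plane} {n : Fin 2 → ℕ} {T : Fin 2 → ℤ → ℝ} {j : Index} {x : Plane}

theorem P_tensor (j : Index) (q₀ q₁ : ℝ[X]) :
    P Ω n T j (fun y => q₀.eval (y 0) * q₁.eval (y 1)) =
      (∑ l, weight (n 0) (condKnots Ω n T j 0) (j.1 0) l *
        q₀.eval (evalPt (n 0) (condKnots Ω n T j 0) (j.1 0) l)) *
      ∑ l, weight (n 1) (condKnots Ω n T j 1) (j.1 1) l *
        q₁.eval (evalPt (n 1) (condKnots Ω n T j 1) (j.1 1) l) := by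
  rw [P, Finset.sum_mul_sum]
  refine Finset.sum_congr rfl fun l₁ _ => Finset.sum_congr rfl fun l₂ _ => ?_
  simp only [Matrix.cons_val_zero, Matrix.cons_val_one]
  ring

theorem P_sum (j : Index) {ι : Type*} (S : Finset ι) (c : ι → ℝ) (F : ι → Plane → ℝ) :
    P Ω n T j (fun y => ∑ s ∈ S, c s * F s y) = ∑ s ∈ S, c s * P Ω n T j (F s) := by
  simp only [P, Finset.mul_sum]
  symm
  rw [Finset.sum_comm]
  refine Finset.sum_congr rfl fun l₁ _ => ?_
  rw [Finset.sum_comm]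
  refine Finset.sum_congr rfl fun l₂ _ => Finset.sum_congr rfl fun s _ => ?_
  ring

/-- Reproduction of tensor product polynomials. -/
theorem sum_cdB_mul_P_tensor (K : IsKnots h₀ Ω n T) (G : GraphDomain h₀ Ω) (hx : x ∈ Ω)
    {k : Fin 2 → ℤ} (hk : ∀ σ, T σ (k σ) ≤ x σ ∧ x σ < T σ (k σ + 1)) {q₀ q₁ : ℝ[X]}
    (hq₀ : q₀.natDegree < n 0) (hq₁ : q₁.natDegree < n 1) :
    ∑ s ∈ Finset.range (n 0) ×ˢ Finset.range (n 1), cdB Ω n T (indexAt Ω n T k x s) x *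
      P Ω n T (indexAt Ω n T k x s) (fun y => q₀.eval (y 0) * q₁.eval (y 1)) =
      q₀.eval (x 0) * q₁.eval (x 1) := by
  set J := indexAt Ω n T k x with hJdef
  have hJ : ∀ {s : ℕ × ℕ}, s.1 < n 0 → s.2 < n 1 → J s ∈ indexSet Ω n T ∧ x ∈ (J s).2 :=
    fun h1 h2 => indexAt_mem K hx (fun σ => ⟨(hk σ).1, (hk σ).2.le⟩) h1 h2
  set φ₀ : (ℤ → ℝ) → ℕ → ℝ := fun t s => bspline t (n 0) (k 0 - s) (x 0) *
    ∑ l, weight (n 0) t (k 0 - s) l * q₀.eval (evalPt (n 0) t (k 0 - s) l) with hφ₀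
  set φ₁ : (ℤ → ℝ) → ℕ → ℝ := fun t s => bspline t (n 1) (k 1 - s) (x 1) *
    ∑ l, weight (n 1) t (k 1 - s) l * q₁.eval (evalPt (n 1) t (k 1 - s) l) with hφ₁
  have hterm : ∀ s ∈ Finset.range (n 0) ×ˢ Finset.range (n 1), cdB Ω n T (J s) x *
      P Ω n T (J s) (fun y => q₀.eval (y 0) * q₁.eval (y 1)) =
      φ₀ (condKnots Ω n T (J s) 0) s.1 * φ₁ (condKnots Ω n T (J s) 1) s.2 := by
    intro s hs
    obtain ⟨h1, h2⟩ := Finset.mem_product.1 hs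
    rw [P_tensor, cdB, Set.indicator_of_mem (hJ (Finset.mem_range.1 h1) (Finset.mem_range.1 h2)).2,
      Fin.prod_univ_two]
    have e0 : (J s).1 0 = k 0 - s.1 := rfl
    have e1 : (J s).1 1 = k 1 - s.2 := rfl
    rw [hφ₀, hφ₁, e0, e1]
    ring
  have hsum₀ : ∀ {s : ℕ × ℕ}, s.1 < n 0 → s.2 < n 1 →
      ∑ r ∈ Finset.range (n 0), φ₀ (condKnots Ω n T (J s) 0) r = q₀.eval (x 0) := by
    intro s h1 h2
    have hω := mem_omega_of_mem G (hJ h1 h2).1 (hJ h1 h2).2 0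
    exact sum_bspline_mul_functional (condKnots_monotone K _ 0) (K.order_pos 0)
      ((condense_le_iff hω _).2 (hk 0).1)
      (not_le.1 (mt (condense_le_iff hω _).1 (hk 0).2.not_ge)) hq₀
  have hsum₁ : ∀ {s : ℕ × ℕ}, s.1 < n 0 → s.2 < n 1 →
      ∑ r ∈ Finset.range (n 1), φ₁ (condKnots Ω n T (J s) 1) r = q₁.eval (x 1) := by
    intro s h1 h2
    have hω := mem_omega_of_mem G (hJ h1 h2).1 (hJ h1 h2).2 1
    exact sum_bspline_mul_functional (condKnots_monotone K _ 1) (K.order_pos 1)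
      ((condense_le_iff hω _).2 (hk 1).1)
      (not_le.1 (mt (condense_le_iff hω _).1 (hk 1).2.not_ge)) hq₁
  rw [Finset.sum_congr rfl hterm]
  -- The direction of a chart at x decides the order of summation: the transverse index is summed
  -- first.
  obtain ⟨σ, s, a, b, c, ψ, hc, -⟩ := G.exists_chart hx
  have hT : ∀ {s : ℕ × ℕ}, s.1 < n 0 → s.2 < n 1 → condKnots Ω n T (J s) σ = T σ :=
    fun h1 h2 => condKnots_eq_of_chart K G (hJ h1 h2).1 (hJ h1 h2).2 hc
  have p0 : 0 < n 0 := K.order_pos 0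
  have p1 : 0 < n 1 := K.order_pos 1
  fin_cases σ
  · rw [Finset.sum_product]
    have hinner : ∀ s₁ ∈ Finset.range (n 0), ∑ s₂ ∈ Finset.range (n 1),
        φ₀ (condKnots Ω n T (J (s₁, s₂)) 0) s₁ * φ₁ (condKnots Ω n T (J (s₁, s₂)) 1) s₂ =
        φ₀ (condKnots Ω n T (J (0, 0)) 0) s₁ * q₁.eval (x 1) := by
      intro s₁ h1
      have h1' := Finset.mem_range.1 h1
      rw [← hsum₁ (s := (s₁, 0)) h1' p1, Finset.mul_sum]
      refine Finset.sum_congr rfl fun s₂ h2 => ?_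
      have h2' := Finset.mem_range.1 h2
      -- Along the chart the knots are the original ones for every index; across it they depend on
      -- s₁ only.
      have e0 : condKnots Ω n T (J (s₁, s₂)) 0 = condKnots Ω n T (J (0, 0)) 0 :=
        (hT (s := (s₁, s₂)) h1' h2').trans (hT (s := (0, 0)) p0 p1).symm
      have e1 : condKnots Ω n T (J (s₁, s₂)) 1 = condKnots Ω n T (J (s₁, 0)) 1 :=
        condKnots_congr (hJ (s := (s₁, s₂)) h1' h2').1 (hJ (s := (s₁, 0)) h1' p1).1
          (hJ (s := (s₁, s₂)) h1' h2').2 (hJ (s := (s₁, 0)) h1' p1).2 rfl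
      rw [e0, e1]
    rw [Finset.sum_congr rfl hinner, ← Finset.sum_mul, hsum₀ (s := (0, 0)) p0 p1]
  · rw [Finset.sum_product_right]
    have hinner : ∀ s₂ ∈ Finset.range (n 1), ∑ s₁ ∈ Finset.range (n 0),
        φ₀ (condKnots Ω n T (J (s₁, s₂)) 0) s₁ * φ₁ (condKnots Ω n T (J (s₁, s₂)) 1) s₂ =
        q₀.eval (x 0) * φ₁ (condKnots Ω n T (J (0, 0)) 1) s₂ := by
      intro s₂ h2
      have h2' := Finset.mem_range.1 h2
      rw [← hsum₀ (s := (0, s₂)) p0 h2', Finset.sum_mul]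
      refine Finset.sum_congr rfl fun s₁ h1 => ?_
      have h1' := Finset.mem_range.1 h1
      have e1 : condKnots Ω n T (J (s₁, s₂)) 1 = condKnots Ω n T (J (0, 0)) 1 :=
        (hT (s := (s₁, s₂)) h1' h2').trans (hT (s := (0, 0)) p0 p1).symm
      have e0 : condKnots Ω n T (J (s₁, s₂)) 0 = condKnots Ω n T (J (0, s₂)) 0 :=
        condKnots_congr (hJ (s := (s₁, s₂)) h1' h2').1 (hJ (s := (0, s₂)) p0 h2').1
          (hJ (s := (s₁, s₂)) h1' h2').2 (hJ (s := (0, s₂)) p0 h2').2 rfl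
      rw [e0, e1]
    rw [Finset.sum_congr rfl hinner, ← Finset.mul_sum, hsum₁ (s := (0, 0)) p0 p1]

/-- An admissible box is a box with side lengths `h_j^*`, at a distance from the support of the
condensed B-spline that is controlled by the side lengths. -/
theorem IsLocalBox.isBox (K : IsKnots h₀ Ω n T) (G : GraphDomain h₀ Ω) (hj : j ∈ indexSet Ω n T)
    {H : Set Plane} (hH : IsLocalBox Ω n T j H) :
    H ⊆ Ω ∧ ∃ lo : Plane, IsBox H lo (lo + condWidth Ω n T j) ∧
      ∀ ρ, ∀ u ∈ Set.Icc (condKnots Ω n T j ρ (j.1 ρ)) (condKnots Ω n T j ρ (j.1 ρ + n ρ)),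
        |u - lo ρ| ≤ ((max (n 0) (n 1) : ℕ) + 1) * condWidth Ω n T j ρ := by
  obtain ⟨σ, e, V, l, I, x, hV, hI1, hI2, hI3, hx, hxe, hxI, rfl, hsub⟩ := hH
  refine ⟨fun y hy => (componentOf_subset (hsub hy)).2, ?_⟩
  have hpos := fun ρ => condWidth_pos K G hj ρ
  have hω := fun ρ => mem_omega_of_mem G hj hx ρ
  have hxs := (indexSet_subset hj hx).1
  set h := condWidth Ω n T j with hh
  obtain ⟨v, hVv, hv⟩ : ∃ v, V = Set.Icc v (v + h σ) ∧ e ∈ Set.Icc v (v + h σ) := by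
    have := hpos σ
    rcases hV with ⟨-, rfl⟩ | ⟨-, rfl⟩
    · exact ⟨e - h σ, by rw [sub_add_cancel], by linarith, by linarith⟩
    · exact ⟨e, rfl, le_rfl, by linarith⟩
  have hlo : ∀ ρ, x ρ ∈ Set.Icc (planeMk σ v l ρ) (planeMk σ v l ρ + h ρ) := by
    intro ρ
    rcases eq_or_eq_one_sub σ ρ with rfl | rfl
    · rw [planeMk_same, hxe]; exact hv
    · rw [planeMk_other]; exact hI2 hxI
  refine ⟨planeMk σ v l, ⟨Function.update (fun _ => I) σ V, ?_, fun ρ => ?_⟩, fun ρ u hu => ?_⟩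
  · ext y
    simp only [Set.mem_ofPred_eq, Set.mem_pi, Set.mem_univ, forall_true_left]
    constructor
    · rintro ⟨h1, h2⟩ ρ
      rcases eq_or_eq_one_sub σ ρ with rfl | rfl
      · simpa using h1
      · rwa [Function.update_of_ne (by fin_cases σ <;> simp)]
    · intro hy
      have h1 := hy σ
      have h2 := hy (1 - σ)
      rw [Function.update_self] at h1
      rw [Function.update_of_ne (by fin_cases σ <;> simp)] at h2
      exact ⟨h1, h2⟩
  · rcases eq_or_eq_one_sub σ ρ with rfl | rfl
    · rw [Pi.add_apply, planeMk_same, Function.update_self, hVv]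
      exact ⟨by linarith [hpos ρ], Set.Ioo_subset_Icc_self, le_rfl⟩
    · rw [Pi.add_apply, planeMk_other, Function.update_of_ne (by fin_cases σ <;> simp)]
      exact ⟨by linarith [hpos (1 - σ)], hI1, hI2⟩
  -- The point x lies in the box and between the outer condensed knots. The distance is at most n̄h*
  -- within the support plus h* within the box.
  · have h1 : condKnots Ω n T j ρ (j.1 ρ) ≤ x ρ := (condense_le_iff (hω ρ) _).2 (hxs.1 ρ)
    have h2 : x ρ ≤ condKnots Ω n T j ρ (j.1 ρ + n ρ) := (le_condense_iff (hω ρ) _).2 (hxs.2 ρ)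
    have h3 : condKnots Ω n T j ρ (j.1 ρ + n ρ) - condKnots Ω n T j ρ (j.1 ρ) ≤ n ρ * h ρ :=
      sub_le_mul_of_gap_le (le_maxGap_condense (K.monotone ρ) (K.gap ρ)) _ _
    have h4 : (n ρ : ℝ) * h ρ ≤ (max (n 0) (n 1) : ℕ) * h ρ :=
      mul_le_mul_of_nonneg_right (Nat.cast_le.2 (order_le_max n ρ)) (hpos ρ).le
    have h5 := hlo ρ
    rw [add_one_mul, abs_le]
    constructor <;> linarith [hu.1, hu.2, h5.1, h5.2]

/-- The quasi-interpolant reproduces polynomials. -/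
theorem Q_mvPolynomial (K : IsKnots h₀ Ω n T) (G : GraphDomain h₀ Ω) {H : Index → Set Plane}
    (hH : ∀ j ∈ indexSet Ω n T, IsLocalBox Ω n T j (H j)) (q : MvPolynomial (Fin 2) ℝ)
    (hq : ∀ σ, q.degreeOf σ < n σ) (hx : x ∈ Ω) :
    Q Ω n T H (fun y => MvPolynomial.eval y q) x = MvPolynomial.eval x q := by
  choose k hk using fun σ => K.exists_knot G.isOpen hx σ
  rw [Q, finsum_cdB_mul K G hx hk]
  have hA : ∀ s ∈ Finset.range (n 0) ×ˢ Finset.range (n 1),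
      cdB Ω n T (indexAt Ω n T k x s) x * P Ω n T (indexAt Ω n T k x s)
        (A n (H (indexAt Ω n T k x s)) fun y => MvPolynomial.eval y q) =
      ∑ m ∈ q.support, q.coeff m * (cdB Ω n T (indexAt Ω n T k x s) x *
        P Ω n T (indexAt Ω n T k x s) fun y =>
          (X ^ m 0 : ℝ[X]).eval (y 0) * (X ^ m 1 : ℝ[X]).eval (y 1)) := by
    intro s hs
    obtain ⟨h1, h2⟩ := Finset.mem_product.1 hs
    obtain ⟨hj, -⟩ := indexAt_mem K hx (fun σ => ⟨(hk σ).1, (hk σ).2.le⟩)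
      (Finset.mem_range.1 h1) (Finset.mem_range.1 h2)
    obtain ⟨-, lo, hbox, -⟩ := IsLocalBox.isBox K G hj (hH _ hj)
    -- The projections drop out, and by linearity it suffices to treat monomials.
    rw [funext (A_mvPolynomial hbox n q hq)]
    simp only [eval_eq_sum_tensor]
    rw [P_sum (F := fun (m : Fin 2 →₀ ℕ) (y : Plane) =>
      (X ^ m 0 : ℝ[X]).eval (y 0) * (X ^ m 1 : ℝ[X]).eval (y 1)), Finset.mul_sum]
    exact Finset.sum_congr rfl fun m _ => by ring
  rw [Finset.sum_congr rfl hA, Finset.sum_comm, eval_eq_sum_tensor]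
  refine Finset.sum_congr rfl fun m hm => ?_
  rw [← Finset.mul_sum, sum_cdB_mul_P_tensor K G hx hk (natDegree_of_mem_support hq hm 0)
    (natDegree_of_mem_support hq hm 1)]

end Reproduction

/-! ## Stability -/

section Stability

variable {h₀ : ℝ} {Ω : Set Plane} {n : Fin 2 → ℕ} {T : Fin 2 → ℤ → ℝ} {j : Index} {x : Plane}

/-- The stability constant of the functionals `f ↦ P_j A_j f`. -/
noncomputable def functionalBound (n : Fin 2 → ℕ) : ℝ≥0 :=
  (n 0 * n 1) * ((weightBound (n 0) * weightBound (n 1)).toNNReal *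
    (projectionBound n ((max (n 0) (n 1) : ℕ) + 1)).toNNReal)

/-- The evaluation points lie in the condensed support, hence within (n̄ + 1)h* of the corner of H.
The projection estimate applies there with M = n̄ + 1, and the weights are bounded. -/
theorem enorm_P_A_mul_volume_rpow_le (K : IsKnots h₀ Ω n T) (G : GraphDomain h₀ Ω)
    (hj : j ∈ indexSet Ω n T) {H : Set Plane} (hH : IsLocalBox Ω n T j H) {p : ℝ≥0∞} (hp : 1 ≤ p)
    {f : Plane → ℝ} (hf : MemLp f p (volume.restrict Ω)) :
    ‖P Ω n T j (A n H f)‖ₑ * volume H ^ (1 / p.toReal) ≤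
      functionalBound n * eLpNorm f p (volume.restrict H) := by
  obtain ⟨hHΩ, lo, hbox, hdist⟩ := IsLocalBox.isBox K G hj hH
  set w := (weightBound (n 0) * weightBound (n 1)).toNNReal with hw
  set C := (projectionBound n ((max (n 0) (n 1) : ℕ) + 1)).toNNReal with hC
  have hfH : AEStronglyMeasurable f (volume.restrict H) := hf.aestronglyMeasurable.mono_set hHΩ
  have hterm : ∀ (l₁ : Fin (n 0)) (l₂ : Fin (n 1)),
      ‖weight (n 0) (condKnots Ω n T j 0) (j.1 0) l₁ *
        weight (n 1) (condKnots Ω n T j 1) (j.1 1) l₂ *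
        A n H f ![evalPt (n 0) (condKnots Ω n T j 0) (j.1 0) l₁,
          evalPt (n 1) (condKnots Ω n T j 1) (j.1 1) l₂]‖ₑ * volume H ^ (1 / p.toReal) ≤
      (w * C : ℝ≥0) * eLpNorm f p (volume.restrict H) := by
    intro l₁ l₂
    have hwt : ‖weight (n 0) (condKnots Ω n T j 0) (j.1 0) l₁ *
        weight (n 1) (condKnots Ω n T j 1) (j.1 1) l₂‖ₑ ≤ w := by
      rw [Real.enorm_eq_ofReal_abs, abs_mul]
      exact ENNReal.ofReal_le_ofReal (mul_le_mul (abs_weight_le (condKnots_monotone K j 0) _ _)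
        (abs_weight_le (condKnots_monotone K j 1) _ _) (abs_nonneg _)
        (weightBound_nonneg (K.order_pos 0)))
    rw [enorm_mul, mul_assoc, ENNReal.coe_mul, mul_assoc]
    refine mul_le_mul' hwt (enorm_A_mul_volume_rpow_le hbox n hp hfH (by positivity) fun ρ => ?_)
    rw [Pi.add_apply, add_sub_cancel_left]
    refine hdist ρ _ ?_
    fin_cases ρ
    · exact evalPt_mem (condKnots_monotone K j 0) _ l₁
    · exact evalPt_mem (condKnots_monotone K j 1) _ l₂
  calc _ ≤ (∑ l₁ : Fin (n 0), ∑ l₂ : Fin (n 1),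
        ‖weight (n 0) (condKnots Ω n T j 0) (j.1 0) l₁ *
          weight (n 1) (condKnots Ω n T j 1) (j.1 1) l₂ *
          A n H f ![evalPt (n 0) (condKnots Ω n T j 0) (j.1 0) l₁,
            evalPt (n 1) (condKnots Ω n T j 1) (j.1 1) l₂]‖ₑ) * volume H ^ (1 / p.toReal) := by
        gcongr
        rw [P]
        exact (enorm_sum_le _ _).trans (Finset.sum_le_sum fun l₁ _ => enorm_sum_le _ _)
    _ ≤ ∑ l₁ : Fin (n 0), ∑ l₂ : Fin (n 1),
        (w * C : ℝ≥0) * eLpNorm f p (volume.restrict H) := by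
        simp only [Finset.sum_mul]
        exact Finset.sum_le_sum fun l₁ _ => Finset.sum_le_sum fun l₂ _ => hterm l₁ l₂
    _ = _ := by
        rw [functionalBound, ← hw, ← hC]
        simp only [Finset.sum_const, Finset.card_univ, Fintype.card_fin, nsmul_eq_mul]
        push_cast
        ring

/-! ### Components of grid cells -/

variable {k : Fin 2 → ℤ} {Γ : Set Plane}

/-- The interior of a grid cell. -/
def openCell (T : Fin 2 → ℤ → ℝ) (k : Fin 2 → ℤ) : Set Plane :=
  Set.univ.pi fun σ => Set.Ioo (T σ (k σ - 1)) (T σ (k σ))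

theorem isOpen_openCell (T : Fin 2 → ℤ → ℝ) (k : Fin 2 → ℤ) : IsOpen (openCell T k) :=
  isOpen_set_pi Set.finite_univ fun _ _ => isOpen_Ioo

theorem openCell_subset (T : Fin 2 → ℤ → ℝ) (k : Fin 2 → ℤ) : openCell T k ⊆ gridCell T k :=
  fun _ hx => ⟨fun σ => (hx σ trivial).1.le, fun σ => (hx σ trivial).2.le⟩

theorem interior_gridCell (T : Fin 2 → ℤ → ℝ) (k : Fin 2 → ℤ) :
    interior (gridCell T k) = openCell T k := by
  rw [gridCell, ← Set.pi_univ_Icc, interior_pi_set Set.finite_univ]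
  simp only [interior_Icc, openCell]

theorem openCell_ae_eq (T : Fin 2 → ℤ → ℝ) (k : Fin 2 → ℤ) :
    openCell T k =ᵐ[volume] gridCell T k := by
  rw [gridCell, ← Set.pi_univ_Icc]
  exact Measure.ae_eq_set_pi fun _ _ => Ioo_ae_eq_Icc

/-- The boundary of a cell is a null set, so pointwise bounds are only needed at inner points, where
no knot is met. -/
theorem component_ae_eq (hΓ : Γ ∈ components Ω (gridCell T k)) :
    (Γ ∩ openCell T k : Set Plane) =ᵐ[volume] Γ := by
  have h : (Γ ∩ gridCell T k : Set Plane) = Γ :=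
    Set.inter_eq_left.2 fun y hy => (components_subset hΓ hy).1
  conv_rhs => rw [← h]
  exact (ae_eq_refl _).inter (openCell_ae_eq T k)

/-- A component of a grid cell contains a ball around each of its points inside the cell. -/
theorem exists_ball_subset_component (hΩ : IsOpen Ω) (hΓ : Γ ∈ components Ω (gridCell T k))
    (hx : x ∈ Γ) (hxk : x ∈ openCell T k) :
    ∃ ε > 0, Metric.ball x ε ⊆ Γ ∧ Metric.ball x ε ⊆ openCell T k ∩ Ω := by
  obtain ⟨ε, hε, hball⟩ := Metric.isOpen_iff.1 ((isOpen_openCell T k).inter hΩ) x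
    ⟨hxk, (components_subset hΓ hx).2⟩
  refine ⟨ε, hε, ?_, hball⟩
  exact subset_of_mem_components (x := x) hΓ (convex_ball x ε).isPreconnected
    (hball.trans (Set.inter_subset_inter_left _ (openCell_subset T k)))
    (Metric.mem_ball_self hε) hx

theorem isOpen_component_inter (hΩ : IsOpen Ω) (hΓ : Γ ∈ components Ω (gridCell T k)) :
    IsOpen (Γ ∩ openCell T k) := by
  rw [Metric.isOpen_iff]
  rintro x ⟨hx, hxk⟩
  obtain ⟨ε, hε, h1, h2⟩ := exists_ball_subset_component hΩ hΓ hx hxk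
  exact ⟨ε, hε, fun y hy => ⟨h1 hy, (h2 hy).1⟩⟩

/-- A grid cell that meets `S_i` in an inner point is contained in `S_i`. -/
theorem index_bounds_of_mem (K : IsKnots h₀ Ω n T) {i : Fin 2 → ℤ} (hx : x ∈ openCell T k)
    (hxi : x ∈ suppBox n T i) (σ : Fin 2) : i σ ≤ k σ - 1 ∧ k σ - 1 < i σ + n σ := by
  obtain ⟨h1, h2⟩ := hx σ trivial
  constructor
  · by_contra h
    have := K.monotone σ (show k σ ≤ i σ by lia)
    linarith [hxi.1 σ]
  · by_contra h
    have := K.monotone σ (show i σ + n σ ≤ k σ - 1 by lia)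
    linarith [hxi.2 σ]

/-- An interior point of the overlap is interior to the cell, which forces the whole cell into S_i.
Then Γ is a connected part of S_i ∩ Ω that meets γ. -/
theorem component_subset_of_relevant (K : IsKnots h₀ Ω n T)
    (hΓ : Γ ∈ components Ω (gridCell T k)) (hj : j ∈ relevant Ω n T Γ) :
    Γ ⊆ j.2 ∧ ∀ σ, j.1 σ ≤ k σ - 1 ∧ k σ - 1 < j.1 σ + n σ := by
  obtain ⟨hj, z, hz⟩ := hj
  obtain ⟨hzj, hzΓ⟩ := interior_subset hz
  have hzk : z ∈ openCell T k := by
    rw [← interior_gridCell]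
    exact interior_mono (fun y hy => (components_subset hΓ hy.2).1) hz
  have hb := index_bounds_of_mem K hzk (indexSet_subset hj hzj).1
  refine ⟨subset_of_mem_components (x := z) hj (components_isPreconnected hΓ) (fun y hy => ?_)
    hzΓ hzj, hb⟩
  obtain ⟨hyk, hyΩ⟩ := components_subset hΓ hy
  refine ⟨⟨fun σ => ?_, fun σ => ?_⟩, hyΩ⟩
  · exact (K.monotone σ (hb σ).1).trans (hyk.1 σ)
  · exact (hyk.2 σ).trans (K.monotone σ (by have := (hb σ).2; lia))

theorem relevant_finite (K : IsKnots h₀ Ω n T) (hΓ : Γ ∈ components Ω (gridCell T k)) :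
    (relevant Ω n T Γ).Finite := by
  obtain ⟨y, hy⟩ := components_nonempty hΓ
  refine ((Finset.range (n 0) ×ˢ Finset.range (n 1)).finite_toSet.image
    (indexAt Ω n T (fun σ => k σ - 1) y)).subset fun j hj => ?_
  obtain ⟨hsub, hb⟩ := component_subset_of_relevant K hΓ hj
  obtain ⟨s, hs, h⟩ := exists_eq_indexAt hj.1 (hsub hy) hb
  exact ⟨s, hs, h⟩

/-- In each direction σ, any two points of Γ lie in ω_(σ,j) and in one knot interval. The bounding
box of Γ has therefore sides at most h_j^*, which are the sides of H. -/
theorem volume_component_le (K : IsKnots h₀ Ω n T) (G : GraphDomain h₀ Ω)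
    (hΓ : Γ ∈ components Ω (gridCell T k)) (hj : j ∈ relevant Ω n T Γ) {H : Set Plane}
    (hH : IsLocalBox Ω n T j H) : volume Γ ≤ volume H := by
  obtain ⟨hsub, -⟩ := component_subset_of_relevant K hΓ hj
  obtain ⟨-, lo, hbox, -⟩ := IsLocalBox.isBox K G hj.1 hH
  have hne := components_nonempty hΓ
  have hΓΩ : Γ ⊆ Ω := fun y hy => (components_subset hΓ hy).2
  have hsize : ∀ σ, upper Γ σ - lower Γ σ ≤ condWidth Ω n T j σ := by
    intro σ
    rw [sub_le_iff_le_add]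
    refine upper_le hne fun y hy => ?_
    rw [← sub_le_iff_le_add']
    refine le_lower hne fun z hz => ?_
    have := sub_le_maxGap_condense (K.monotone σ) (K.gap σ)
      (mem_omega_of_mem G hj.1 (hsub hz) σ) (mem_omega_of_mem G hj.1 (hsub hy) σ)
      (k := k σ - 1) ((components_subset hΓ hz).1.1 σ)
      (by rw [sub_add_cancel]; exact (components_subset hΓ hy).1.2 σ)
    change y σ - z σ ≤ condWidth Ω n T j σ at this
    linarith
  have hle : ∀ σ, 0 ≤ upper Γ σ - lower Γ σ := by
    intro σ
    obtain ⟨y, hy⟩ := hne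
    linarith [G.lower_le hΓΩ hy σ, G.le_upper hΓΩ hy σ]
  calc volume Γ ≤ volume (Set.Icc (lower Γ) (upper Γ)) :=
        measure_mono fun y hy => ⟨fun σ => G.lower_le hΓΩ hy σ, fun σ => G.le_upper hΓΩ hy σ⟩
    _ = ENNReal.ofReal (upper Γ 0 - lower Γ 0) * ENNReal.ofReal (upper Γ 1 - lower Γ 1) := by
        rw [Real.volume_Icc_pi, Fin.prod_univ_two]
    _ = ENNReal.ofReal ((upper Γ 0 - lower Γ 0) * (upper Γ 1 - lower Γ 1)) :=
        (ENNReal.ofReal_mul (hle 0)).symm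
    _ ≤ volume H := by
        rw [hbox.volume_eq]
        simp only [Pi.add_apply, add_sub_cancel_left]
        exact ENNReal.ofReal_le_ofReal (mul_le_mul (hsize 0) (hsize 1) (hle 1)
          ((hle 0).trans (hsize 0)))

/-- The stability constant of the quasi-interpolant. -/
noncomputable def stabilityBound (n : Fin 2 → ℕ) : ℝ≥0 :=
  (n 0 * n 1) * (2 ^ (n 0 + n 1) * functionalBound n)

/-- Pointwise stability at the inner points of a component of a grid cell. -/
theorem enorm_Q_mul_volume_rpow_le (K : IsKnots h₀ Ω n T) (G : GraphDomain h₀ Ω)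
    {H : Index → Set Plane} (hH : ∀ j ∈ indexSet Ω n T, IsLocalBox Ω n T j (H j)) {p : ℝ≥0∞}
    (hp : 1 ≤ p) {f : Plane → ℝ} (hf : MemLp f p (volume.restrict Ω))
    (hΓ : Γ ∈ components Ω (gridCell T k)) (hx : x ∈ Γ) (hxk : x ∈ openCell T k) :
    ‖Q Ω n T H f x‖ₑ * volume Γ ^ (1 / p.toReal) ≤
      stabilityBound n * ⨆ j ∈ relevant Ω n T Γ, eLpNorm f p (volume.restrict (H j)) := by
  set S := ⨆ j ∈ relevant Ω n T Γ, eLpNorm f p (volume.restrict (H j)) with hS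
  have hxΩ := (components_subset hΓ hx).2
  -- Cells are labelled by their upper knots, so the knot interval of x has index k - 1.
  have hk : ∀ σ, T σ (k σ - 1) ≤ x σ ∧ x σ < T σ (k σ - 1 + 1) := fun σ => by
    rw [sub_add_cancel]; exact ⟨(hxk σ trivial).1.le, (hxk σ trivial).2⟩
  rw [Q, finsum_cdB_mul K G hxΩ (k := fun σ => k σ - 1) hk]
  set J := indexAt Ω n T (fun σ => k σ - 1) x
  have hterm : ∀ s ∈ Finset.range (n 0) ×ˢ Finset.range (n 1),
      ‖cdB Ω n T (J s) x * P Ω n T (J s) (A n (H (J s)) f)‖ₑ * volume Γ ^ (1 / p.toReal) ≤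
        (2 ^ (n 0 + n 1) * functionalBound n : ℝ≥0) * S := by
    intro s hs
    obtain ⟨h1, h2⟩ := Finset.mem_product.1 hs
    obtain ⟨hj, hxj⟩ := indexAt_mem K hxΩ (k := fun σ => k σ - 1)
      (fun σ => ⟨(hk σ).1, (hk σ).2.le⟩) (Finset.mem_range.1 h1) (Finset.mem_range.1 h2)
    -- A small ball around x lies in Γ and, being connected and inside S_i ∩ Ω, also in the support.
    -- The overlap thus has an interior point.
    have hrel : J s ∈ relevant Ω n T Γ := by
      obtain ⟨ε, hε, hball, hball'⟩ := exists_ball_subset_component G.isOpen hΓ hx hxk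
      refine ⟨hj, x, mem_interior.2 ⟨Metric.ball x ε, fun y hy => ⟨?_, hball hy⟩,
        Metric.isOpen_ball, Metric.mem_ball_self hε⟩⟩
      refine subset_of_mem_components (x := x) hj (convex_ball x ε).isPreconnected
        (fun z hz => ⟨mem_suppBox_sub K (k := fun σ => k σ - 1) (fun σ => ?_)
          (Finset.mem_range.1 h1) (Finset.mem_range.1 h2), (hball' hz).2⟩)
        (Metric.mem_ball_self hε) hxj hy
      rw [sub_add_cancel]
      exact ⟨((hball' hz).1 σ trivial).1.le, ((hball' hz).1 σ trivial).2.le⟩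
    have hB : ‖cdB Ω n T (J s) x‖ₑ ≤ ((2 ^ (n 0 + n 1) : ℝ≥0) : ℝ≥0∞) := by
      rw [Real.enorm_eq_ofReal_abs]
      refine (ENNReal.ofReal_le_ofReal (abs_cdB_le K _ _)).trans_eq ?_
      rw [ENNReal.ofReal_pow zero_le_two]
      simp
    rw [enorm_mul, mul_assoc, ENNReal.coe_mul, mul_assoc]
    refine mul_le_mul' hB ?_
    calc _ ≤ ‖P Ω n T (J s) (A n (H (J s)) f)‖ₑ * volume (H (J s)) ^ (1 / p.toReal) := by
          exact mul_le_mul' le_rfl (ENNReal.rpow_le_rpow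
            (volume_component_le K G hΓ hrel (hH _ hj)) (by positivity))
      _ ≤ functionalBound n * eLpNorm f p (volume.restrict (H (J s))) :=
          enorm_P_A_mul_volume_rpow_le K G hj (hH _ hj) hp hf
      _ ≤ functionalBound n * S := by
          gcongr
          exact le_iSup₂ (f := fun j (_ : j ∈ relevant Ω n T Γ) =>
            eLpNorm f p (volume.restrict (H j))) (J s) hrel
  calc _ ≤ (∑ s ∈ Finset.range (n 0) ×ˢ Finset.range (n 1),
        ‖cdB Ω n T (J s) x * P Ω n T (J s) (A n (H (J s)) f)‖ₑ) * volume Γ ^ (1 / p.toReal) := by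
        gcongr
        exact enorm_sum_le _ _
    _ ≤ ∑ s ∈ Finset.range (n 0) ×ˢ Finset.range (n 1),
        (2 ^ (n 0 + n 1) * functionalBound n : ℝ≥0) * S := by
        rw [Finset.sum_mul]
        exact Finset.sum_le_sum hterm
    _ = _ := by
        simp only [Finset.sum_const, Finset.card_product, Finset.card_range, nsmul_eq_mul,
          stabilityBound]
        push_cast
        ring

/-- Stability of the quasi-interpolant. -/
theorem eLpNorm_Q_le (K : IsKnots h₀ Ω n T) (G : GraphDomain h₀ Ω)
    {H : Index → Set Plane} (hH : ∀ j ∈ indexSet Ω n T, IsLocalBox Ω n T j (H j)) {p : ℝ≥0∞}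
    (hp : 1 ≤ p) {f : Plane → ℝ} (hf : MemLp f p (volume.restrict Ω))
    (hΓ : Γ ∈ components Ω (gridCell T k)) :
    eLpNorm (Q Ω n T H f) p (volume.restrict Γ) ≤
      stabilityBound n * ⨆ j ∈ relevant Ω n T Γ, eLpNorm f p (volume.restrict (H j)) := by
  set D := stabilityBound n * ⨆ j ∈ relevant Ω n T Γ, eLpNorm f p (volume.restrict (H j))
  -- For a null component the left-hand side is 0. Otherwise |Γ|^(1/p) is a positive finite number
  -- by which one may divide.
  rcases eq_or_ne (volume Γ) 0 with h0 | h0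
  · rw [Measure.restrict_eq_zero.2 h0, eLpNorm_measure_zero]
    exact zero_le
  have hfin : volume Γ ≠ ∞ := by
    have hcell : volume (gridCell T k) < ∞ := isCompact_Icc.measure_lt_top
    exact ((measure_mono fun y hy => (components_subset hΓ hy).1).trans_lt hcell).ne
  set v := volume Γ ^ (1 / p.toReal) with hv
  have hv0 : v ≠ 0 := by simp [hv, ENNReal.rpow_eq_zero_iff, h0, hfin]
  have hvt : v ≠ ∞ := by simp [hv, ENNReal.rpow_eq_top_iff, h0, hfin]
  have hae : ∀ᵐ x ∂(volume.restrict Γ), ‖Q Ω n T H f x‖ₑ ≤ D / v := by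
    rw [← Measure.restrict_congr_set (component_ae_eq hΓ)]
    refine ae_restrict_of_forall_mem (isOpen_component_inter G.isOpen hΓ).measurableSet ?_
    rintro x ⟨hx, hxk⟩
    rw [ENNReal.le_div_iff_mul_le (Or.inl hv0) (Or.inl hvt)]
    exact enorm_Q_mul_volume_rpow_le K G hH hp hf hΓ hx hxk
  refine (eLpNorm_le_of_ae_enorm_bound hae).trans_eq ?_
  rw [Measure.restrict_apply_univ, smul_eq_mul, ← one_div, ENNReal.div_mul_cancel hv0 hvt]

end Stability

end CdSpline

/-! ### Assembly of the theorem -/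

theorem mainTheorem2 (n : Fin 2 → ℕ) (hn : ∀ σ, 1 ≤ n σ) (p : ℝ≥0∞) (hp : 1 ≤ p) :
    ∃ c : ℝ≥0, ∀ (h₀ : ℝ) (Ω : Set CdSpline.Plane) (G : CdSpline.GraphDomain h₀ Ω)
      (T : Fin 2 → ℤ → ℝ),
      (∀ σ, Monotone (T σ)) →
      (∀ σ k, T σ k < T σ (k + n σ)) →
      (∀ σ k, T σ (k + 1) - T σ k ≤ h₀ / ((max (n 0) (n 1) : ℕ) + 1)) →
      (Ω ⊆ ⋃ k, CdSpline.gridCell T k) →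
      (G.GraphsInBoundary → ∃ H : CdSpline.Index → Set CdSpline.Plane,
        ∀ j ∈ CdSpline.indexSet Ω n T, CdSpline.IsLocalBox Ω n T j (H j)) ∧
      ∀ H : CdSpline.Index → Set CdSpline.Plane,
        (∀ j ∈ CdSpline.indexSet Ω n T, CdSpline.IsLocalBox Ω n T j (H j)) →
        (∀ q : MvPolynomial (Fin 2) ℝ, (∀ σ, q.degreeOf σ < n σ) →
          ∀ x ∈ Ω, CdSpline.Q Ω n T H (fun y => MvPolynomial.eval y q) x =
            MvPolynomial.eval x q) ∧
        (∀ f : CdSpline.Plane → ℝ, MemLp f p (volume.restrict Ω) →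
          ∀ k : Fin 2 → ℤ, ∀ Γ ∈ CdSpline.components Ω (CdSpline.gridCell T k),
            (CdSpline.relevant Ω n T Γ).Finite ∧
            eLpNorm (CdSpline.Q Ω n T H f) p (volume.restrict Γ) ≤
              c * ⨆ j ∈ CdSpline.relevant Ω n T Γ, eLpNorm f p (volume.restrict (H j))) := by
  refine ⟨CdSpline.stabilityBound n, fun h₀ Ω G T hmono hlt hgap hcover => ?_⟩
  have K : CdSpline.IsKnots h₀ Ω n T := ⟨hn, hmono, hlt, hgap, hcover⟩
  refine ⟨fun hG => ?_, fun H hH => ⟨fun q hq x hx => ?_, fun f hf k Γ hΓ => ⟨?_, ?_⟩⟩⟩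
  -- The choice of boxes is a function on all pairs (i, γ); outside the index set the empty set
  -- serves as a default.
  · have h : ∀ j, ∃ H, j ∈ CdSpline.indexSet Ω n T → CdSpline.IsLocalBox Ω n T j H := by
      intro j
      by_cases hj : j ∈ CdSpline.indexSet Ω n T
      · obtain ⟨H, hH⟩ := CdSpline.exists_isLocalBox K G hG hj
        exact ⟨H, fun _ => hH⟩
      · exact ⟨∅, fun h => absurd h hj⟩
    choose H hH using h
    exact ⟨H, hH⟩
  · exact CdSpline.Q_mvPolynomial K G hH q hq hx
  · exact CdSpline.relevant_finite K hΓ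
  · exact CdSpline.eLpNorm_Q_le K G hH hp hf hΓ
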